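/- Let $U\subset\mathbb R^n$ ($n\ge 1$) be open, with coordinates $x^i$, and let $g_{ij}$ be a smooth Riemannian metric on $U$ with Christoffel symbols $\Gamma^k_{ij}$ and curvature tensor $$R_{ijkl}=\tfrac12\left(\partial_j\partial_k g_{il}+\partial_i\partial_l g_{jk}-\partial_i\partial_k g_{jl}-\partial_j\partial_l g_{ik}\right)+g_{mn}\left(\Gamma^m_{il}\Gamma^n_{jk}-\Gamma^m_{jl}\Gamma^n_{ik}\right).$$ Let $d\mu=\sqrt{|g_{ij}/2\pi|}\,dx$, where $|\cdot|$ is the determinant, let $\rho$ be a real function on $U$, and put $dp=\rho\,dx$. Fix $\bar x\in U$ and write $\bar g=g(\bar x)$, $\bar R=R(\bar x)$. Let the exponential map $\exp_{\bar x}$ be defined and smooth, with values in $U$, on a ball $\bar g(v,v)<\delta^2$. Let $q\mapsto e(q)$ be a differentiable parametrization, by $q=(q^1,\dots,q^{n-1})$ in an open set, of a part of the unit sphere $\bar g_{ij}e^ie^j=1$, with linearly independent derivatives $\xi_\alpha=\partial e/\partial q^\alpha$, and let $(\ell,q)$ be the geodesic spherical coordinates $x=\exp_{\bar x}(\ell\,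 e(q))$. Put $\kappa_{\alpha\beta}(q)=\bar g_{ij}\xi^i_\alpha\xi^j_\beta$, with inverse $\kappa^{\alpha\beta}$, $S^{ij}_\alpha=e^i\xi^j_\alpha-e^j\xi^i_\alpha$, $$\mathcal F(q)=\bar R_{ijkl}\,\kappa^{\alpha\beta}S^{ij}_\alpha S^{kl}_\beta ,\qquad dp_G(\ell,q)=e^{-\ell^2/2}\,\frac{\ell^{n-1}d\ell}{\sqrt{2\pi}}\,\sqrt{\left|\frac{\kappa_{\alpha\beta}(q)}{2\pi}\right|}\,dq .$$ (1) Suppose that $U$ is connected, that $\rho$ is a smooth positive probability density on $U$, that the information potential $\mathcal S=\log\left(\rho\sqrt{|2\pi g^{ij}|}\right)$ satisfies $g_{ij}=-D_iD_j\mathcal S=-\partial_i\partial_j\mathcal S+\Gamma^k_{ij}\partial_k\mathcal S$ on $U$, and that $\mathcal S$ has its maximum at $\bar x$. Let $\mathcal Z=\int_U e^{-\psi^2/2}\,d\mu$, where $\psi^2=g^{ij}\partial_i\mathcal S\,\partial_j\mathcal S$. Then, as $\ell\to0^+$, $$dp(\ell,q)=\frac1{\mathcal Z}\left[1-\frac1{24}\ell^2\mathcal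 F(q)+O(\ell^4)\right]dp_G(\ell,q).$$ (2) If no relation between $g$ and $\rho$ is assumed except that, for some constant $\mathcal Z>0$, $dp=\frac1{\mathcal Z}e^{-\ell^2/2}d\mu$ on the image of the ball, where $\ell$ is the length of the radial geodesic from $\bar x$, then the same expansion holds with $O(\ell^3)$ in place of $O(\ell^4)$. In both cases, the constant in the remainder depends neither on $q$ nor on the parametrization $e$ of the unit sphere. -/

import Mathlib

open Real Set MeasureTheory
open scoped ContDiff Matrix

noncomputable section

namespace FluctuationGeometry

/-- The partial derivative `∂f/∂xⁱ` of a real function of `n` real coordinates. -/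
def pderiv {n : ℕ} (i : Fin n) (f : (Fin n → ℝ) → ℝ) (x : Fin n → ℝ) : ℝ :=
  fderiv ℝ f x (Pi.single i 1)

/-- `g` is a (smooth, positive definite) Riemannian metric on the coordinate domain `U`;
`g x i j` is the component `g_{ij}(x)`. -/
structure IsRiemannianMetric {n : ℕ} (U : Set (Fin n → ℝ))
    (g : (Fin n → ℝ) → Matrix (Fin n) (Fin n) ℝ) : Prop where
  smooth : ∀ i j, ContDiffOn ℝ ∞ (fun x => g x i j) U
  posDef : ∀ x ∈ U, (g x).PosDef

/-- The number `G_{ij} vⁱ wʲ`. -/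
def pairing {n : ℕ} (G : Matrix (Fin n) (Fin n) ℝ) (v w : Fin n → ℝ) : ℝ :=
  ∑ i, ∑ j, G i j * v i * w j

/-- The Levi-Civita connection
`Γᵏ_{ij} = ½ g^{km} (∂_j g_{im} + ∂_i g_{jm} - ∂_m g_{ij})`. -/
def christoffel {n : ℕ} (g : (Fin n → ℝ) → Matrix (Fin n) (Fin n) ℝ) (x : Fin n → ℝ)
    (k i j : Fin n) : ℝ :=
  ∑ m, (g x)⁻¹ k m * (1 / 2) *
    (pderiv j (fun y => g y i m) x + pderiv i (fun y => g y j m) x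
      - pderiv m (fun y => g y i j) x)

/-- The covariant curvature tensor
`R_{ijkl} = ½ (∂_j∂_k g_{il} + ∂_i∂_l g_{jk} - ∂_i∂_k g_{jl} - ∂_j∂_l g_{ik})
  + g_{mn} (Γᵐ_{il} Γⁿ_{jk} - Γᵐ_{jl} Γⁿ_{ik})`
(with this convention `R_{1212}` is positive on a round sphere). -/
def curvature {n : ℕ} (g : (Fin n → ℝ) → Matrix (Fin n) (Fin n) ℝ) (x : Fin n → ℝ)
    (i j k l : Fin n) : ℝ :=
  1 / 2 *
    (pderiv j (pderiv k fun y => g y i l) x + pderiv i (pderiv l fun y => g y j k) x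
      - pderiv i (pderiv k fun y => g y j l) x - pderiv j (pderiv l fun y => g y i k) x)
  + ∑ a, ∑ b, g x a b *
      (christoffel g x a i l * christoffel g x b j k
        - christoffel g x a j l * christoffel g x b i k)

/-- The density `√|g_{ij}/2π|` of the invariant volume element `dμ` with respect to `dx`. -/
def volumeDensity {n : ℕ} (g : (Fin n → ℝ) → Matrix (Fin n) (Fin n) ℝ) (x : Fin n → ℝ) : ℝ :=
  √((2 * π)⁻¹ • g x).det

/-- The probability weight `ω = ρ √|2π g^{ij}|`. -/
def weight {n : ℕ} (g : (Fin n → ℝ) → Matrix (Fin n) (Fin n) ℝ) (ρ : (Fin n → ℝ) → ℝ)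
    (x : Fin n → ℝ) : ℝ :=
  ρ x * √((2 * π) • (g x)⁻¹).det

/-- The information potential `𝒮 = log ω`. -/
def infoPotential {n : ℕ} (g : (Fin n → ℝ) → Matrix (Fin n) (Fin n) ℝ) (ρ : (Fin n → ℝ) → ℝ)
    (x : Fin n → ℝ) : ℝ :=
  Real.log (weight g ρ x)

/-- The square norm `ψ² = g^{ij} ψ_i ψ_j` of the covector field `ψ_i = -∂_i 𝒮`. -/
def psiSq {n : ℕ} (g : (Fin n → ℝ) → Matrix (Fin n) (Fin n) ℝ) (ρ : (Fin n → ℝ) → ℝ)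
    (x : Fin n → ℝ) : ℝ :=
  pairing (g x)⁻¹ (fun i => -pderiv i (infoPotential g ρ) x)
    (fun i => -pderiv i (infoPotential g ρ) x)

/-- The gaussian partition function `𝒵 = ∫ exp(-ψ²/2) dμ`, the normalization constant of the
Riemannian gaussian representation. -/
def partitionFunction {n : ℕ} (U : Set (Fin n → ℝ))
    (g : (Fin n → ℝ) → Matrix (Fin n) (Fin n) ℝ) (ρ : (Fin n → ℝ) → ℝ) : ℝ :=
  ∫ x in U, Real.exp (-(1 / 2) * psiSq g ρ x) * volumeDensity g x

/-- The metric `g` on the connected coordinate domain `U` is the one associated by fluctuation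
geometry with the smooth positive probability density `ρ`: it solves
`g_{ij} = -D_i D_j 𝒮 = -∂_i ∂_j 𝒮 + Γᵏ_{ij} ∂_k 𝒮`. -/
structure IsFluctuationMetric {n : ℕ} (U : Set (Fin n → ℝ))
    (g : (Fin n → ℝ) → Matrix (Fin n) (Fin n) ℝ) (ρ : (Fin n → ℝ) → ℝ) : Prop where
  preconnected : IsPreconnected U
  smooth : ContDiffOn ℝ ∞ ρ U
  pos : ∀ x ∈ U, 0 < ρ x
  integral_eq_one : ∫ x in U, ρ x = 1
  metric_eq : ∀ x ∈ U, ∀ i j, g x i j =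
    -pderiv i (pderiv j (infoPotential g ρ)) x
      + ∑ k, christoffel g x k i j * pderiv k (infoPotential g ρ) x

/-- The open ball of radius `δ` about `0` in the tangent space at `x₀`. -/
def tangentBall {n : ℕ} (g : (Fin n → ℝ) → Matrix (Fin n) (Fin n) ℝ) (x₀ : Fin n → ℝ) (δ : ℝ) :
    Set (Fin n → ℝ) :=
  {v | pairing (g x₀) v v < δ ^ 2}

/-- `E` is the (smooth) exponential map of the metric at `x₀`, i.e. the map of normal
coordinates, on the tangent ball of radius `δ`: the curve `s ↦ E (s v)` is the geodesic of `U`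
that starts at `x₀` with velocity `v`. -/
structure IsExponentialMap {n : ℕ} (U : Set (Fin n → ℝ))
    (g : (Fin n → ℝ) → Matrix (Fin n) (Fin n) ℝ) (x₀ : Fin n → ℝ) (δ : ℝ)
    (E : (Fin n → ℝ) → (Fin n → ℝ)) : Prop where
  smooth : ContDiffOn ℝ ∞ E (tangentBall g x₀ δ)
  mapsTo : MapsTo E (tangentBall g x₀ δ) U
  map_zero : E 0 = x₀
  velocity : ∀ v ∈ tangentBall g x₀ δ, deriv (fun s : ℝ => E (s • v)) 0 = v
  geodesic : ∀ v ∈ tangentBall g x₀ δ, ∀ s ∈ Icc (0 : ℝ) 1, ∀ k,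
    deriv (deriv fun t : ℝ => E (t • v)) s k
      + ∑ i, ∑ j, christoffel g (E (s • v)) k i j
          * deriv (fun t : ℝ => E (t • v)) s i * deriv (fun t : ℝ => E (t • v)) s j = 0

/-- The vectors `ξ_α = ∂e/∂q^α`. -/
def xi {m : ℕ} (e : (Fin m → ℝ) → (Fin (m + 1) → ℝ)) (q : Fin m → ℝ) (α : Fin m) :
    Fin (m + 1) → ℝ :=
  fderiv ℝ e q (Pi.single α 1)

/-- `q ↦ e(q)`, `q ∈ Q`, is a regular parametrization of (a part of) the sphere of unit vectors
for the scalar product `G`. -/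
structure IsSphericalParam {m : ℕ} (G : Matrix (Fin (m + 1)) (Fin (m + 1)) ℝ)
    (Q : Set (Fin m → ℝ)) (e : (Fin m → ℝ) → (Fin (m + 1) → ℝ)) : Prop where
  isOpen : IsOpen Q
  differentiable : DifferentiableOn ℝ e Q
  unit : ∀ q ∈ Q, pairing G (e q) (e q) = 1
  regular : ∀ q ∈ Q, LinearIndependent ℝ (xi e q)

/-- `κ_{αβ}(q) = G_{ij} ξⁱ_α ξʲ_β`. -/
def kappa {m : ℕ} (G : Matrix (Fin (m + 1)) (Fin (m + 1)) ℝ)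
    (e : (Fin m → ℝ) → (Fin (m + 1) → ℝ)) (q : Fin m → ℝ) : Matrix (Fin m) (Fin m) ℝ :=
  Matrix.of fun α β => pairing G (xi e q α) (xi e q β)

/-- `S^{ij}_α(q) = eⁱ ξʲ_α - eʲ ξⁱ_α`. -/
def sTensor {m : ℕ} (e : (Fin m → ℝ) → (Fin (m + 1) → ℝ)) (q : Fin m → ℝ)
    (α : Fin m) (i j : Fin (m + 1)) : ℝ :=
  e q i * xi e q α j - e q j * xi e q α i

/-- The spherical function `ℱ(q) = R̄_{ijkl} κ^{αβ} S^{ij}_α S^{kl}_β`, the curvature being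
evaluated at `x₀`. -/
def sphericalFunction {m : ℕ} (g : (Fin (m + 1) → ℝ) → Matrix (Fin (m + 1)) (Fin (m + 1)) ℝ)
    (x₀ : Fin (m + 1) → ℝ) (e : (Fin m → ℝ) → (Fin (m + 1) → ℝ)) (q : Fin m → ℝ) : ℝ :=
  ∑ i, ∑ j, ∑ k, ∑ l, ∑ α, ∑ β,
    curvature g x₀ i j k l * (kappa (g x₀) e q)⁻¹ α β * sTensor e q α i j * sTensor e q β k l

/-- The coordinate change `(ℓ, q) ↦ x = E(ℓ e(q))` of geodesic spherical coordinates; the tuple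
`p = (ℓ, q¹, …, qᵐ)` has `ℓ` as its entry of index `0`. -/
def sphericalMap {m : ℕ} (E : (Fin (m + 1) → ℝ) → (Fin (m + 1) → ℝ))
    (e : (Fin m → ℝ) → (Fin (m + 1) → ℝ)) (p : Fin (m + 1) → ℝ) : Fin (m + 1) → ℝ :=
  E (p 0 • e (Fin.tail p))

/-- The density of the distribution `ρ dx` in geodesic spherical coordinates: the transformed
density `ρ(x(ℓ,q)) |∂x/∂(ℓ,q)|`. -/
def sphericalDensity {m : ℕ} (ρ : (Fin (m + 1) → ℝ) → ℝ)
    (E : (Fin (m + 1) → ℝ) → (Fin (m + 1) → ℝ)) (e : (Fin m → ℝ) → (Fin (m + 1) → ℝ))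
    (ℓ : ℝ) (q : Fin m → ℝ) : ℝ :=
  ρ (sphericalMap E e (Fin.cons ℓ q)) * |(fderiv ℝ (sphericalMap E e) (Fin.cons ℓ q)).det|

/-- The density of the gaussian distribution `dp_G` in spherical coordinates,
`exp(-ℓ²/2) ℓ^{n-1} (2π)^{-1/2} √|κ_{αβ}/2π|` with `n = m + 1`. -/
def gaussianDensity {m : ℕ} (G : Matrix (Fin (m + 1)) (Fin (m + 1)) ℝ)
    (e : (Fin m → ℝ) → (Fin (m + 1) → ℝ)) (ℓ : ℝ) (q : Fin m → ℝ) : ℝ :=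
  Real.exp (-(1 / 2) * ℓ ^ 2) * (ℓ ^ m / √(2 * π)) * √((2 * π)⁻¹ • kappa G e q).det

/-- In all geodesic spherical coordinates `(ℓ, q)` about `x₀`,
`dp(ℓ,q) = (1/Z) [1 - ℓ² ℱ(q)/24 + O(ℓᵈ)] dp_G(ℓ,q)` as `ℓ → 0⁺`, where the constant in `O(ℓᵈ)`
does not depend on `q`, nor on the parametrization of the unit sphere. -/
def HasAsymptoticDistribution {m : ℕ}
    (g : (Fin (m + 1) → ℝ) → Matrix (Fin (m + 1)) (Fin (m + 1)) ℝ)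
    (ρ : (Fin (m + 1) → ℝ) → ℝ) (x₀ : Fin (m + 1) → ℝ)
    (E : (Fin (m + 1) → ℝ) → (Fin (m + 1) → ℝ)) (Z : ℝ) (d : ℕ) : Prop :=
  ∃ C ε : ℝ, 0 < ε ∧
    ∀ (Q : Set (Fin m → ℝ)) (e : (Fin m → ℝ) → (Fin (m + 1) → ℝ)),
      IsSphericalParam (g x₀) Q e → ∀ q ∈ Q, ∀ ℓ ∈ Ioo 0 ε,
        ∃ r : ℝ, |r| ≤ C * ℓ ^ d ∧
          sphericalDensity ρ E e ℓ q =
            1 / Z * (1 - 1 / 24 * ℓ ^ 2 * sphericalFunction g x₀ e q + r)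
              * gaussianDensity (g x₀) e ℓ q

end FluctuationGeometry

end

/-! Everything rests on the Riemannian Jacobian J(v) = det DE(v) · √|g(E v)| of the exponential map.
The chain rule gives the Jacobian of geodesic spherical coordinates as det DE times a frame
determinant times ℓ^{n-1}, and a Gram determinant identifies the frame factor with √|κ| / √|ḡ|. A
density of Riemannian gaussian form therefore equals (1/Z) · |J(ℓe)| / √|ḡ| · dp_G exactly
(`sphericalDensity_eq`), and only J has to be expanded.

The logarithmic derivative of J is the trace of the covariant derivative of DE. The geodesic
equation at the origin gives DE(0) = id and D²E(0) = -Γ, and its derivative along rays, polarized,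
gives D³E(0). Hence J / √|ḡ| = 1 - Ric(v,v)/6 + O(|v|³) (`exists_expJacobian_bound`). Antisymmetry
of the curvature and the decomposition of ḡ⁻¹ in the frame (e, ξ) give ℱ = 4 Ric(e,e)
(`sphericalFunction_eq`), so the quadratic term is -ℓ²ℱ/24. This is statement (2).

In statement (1) the equation g = -DD𝒮 is rigid. The gradient of 𝒮 has covariant derivative -Id, so
𝒮 + ψ²/2 is constant, and normalization of ρ identifies 1/𝒵 with exp 𝒮(x̄). Along a radial geodesic
γ the covector d𝒮 + t g(γ', ·) is parallel and vanishes at the centre, so the gradient is radial;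
differentiating this relation shows that DE is parallel along radial geodesics (`covDeriv_self`).
Thus J is constant on the ball. Comparison with the second order expansion forces ℱ = 0, and the
expansion holds with remainder zero, in particular with O(ℓ⁴). -/

noncomputable section

namespace FluctuationGeometry

open Real Set MeasureTheory Filter Topology
open scoped ContDiff Matrix

/-! ### Determinants, polarization and Taylor's formula -/

/-- Jacobi's formula for the derivative of a determinant along a curve of matrices. -/
theorem hasDerivAt_det {ι : Type*} [Fintype ι] [DecidableEq ι] {A : ℝ → Matrix ι ι ℝ}
    {A' : Matrix ι ι ℝ} {t : ℝ} (hA : ∀ i j, HasDerivAt (fun s => A s i j) (A' i j) t) :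
    HasDerivAt (fun s => (A s).det) ((A t).adjugate * A').trace t := by
  have hdet : (fun s => (A s).det)
      = fun s => ∑ σ : Equiv.Perm ι, ((σ.sign : ℤ) : ℝ) * ∏ i, A s (σ i) i := by
    funext s
    rw [Matrix.det_apply']
  rw [hdet]
  have h1 : HasDerivAt (fun s => ∑ σ : Equiv.Perm ι, ((σ.sign : ℤ) : ℝ) * ∏ i, A s (σ i) i)
      (∑ σ : Equiv.Perm ι, ((σ.sign : ℤ) : ℝ) *
        ∑ i, (∏ j ∈ Finset.univ.erase i, A t (σ j) j) • A' (σ i) i) t := by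
    refine HasDerivAt.fun_sum fun σ _ => ?_
    refine HasDerivAt.const_mul _ ?_
    exact HasDerivAt.fun_finsetProd fun i _ => hA (σ i) i
  convert h1 using 1
  have h2 : ∀ i, ((A t).adjugate * A') i i
      = ∑ σ : Equiv.Perm ι, ((σ.sign : ℤ) : ℝ) *
        ((∏ j ∈ Finset.univ.erase i, A t (σ j) j) * A' (σ i) i) := by
    intro i
    -- By Cramer's rule a diagonal entry is the determinant with column `i` differentiated; its
    -- Leibniz expansion is the `i`-th term of the product rule.
    have : ((A t).adjugate * A') i i = ((A t).updateCol i (fun k => A' k i)).det := by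
      rw [← Matrix.cramer_apply, Matrix.cramer_eq_adjugate_mulVec]
      rfl
    rw [this, Matrix.det_apply']
    refine Finset.sum_congr rfl fun σ _ => ?_
    rw [← Finset.prod_erase_mul _ _ (Finset.mem_univ i)]
    congr 2
    · refine Finset.prod_congr rfl fun j hj => ?_
      simp [Finset.ne_of_mem_erase hj]
    · simp
  simp only [Matrix.trace, Matrix.diag_apply, h2, smul_eq_mul, Finset.mul_sum]
  exact Finset.sum_comm

/-- A determinant of smooth entries is smooth. -/
theorem contDiffOn_det {ι V : Type*} [Fintype ι] [DecidableEq ι] [NormedAddCommGroup V]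
    [NormedSpace ℝ V] {A : V → Matrix ι ι ℝ} {s : Set V} {n : WithTop ℕ∞}
    (hA : ∀ i j, ContDiffOn ℝ n (fun x => A x i j) s) : ContDiffOn ℝ n (fun x => (A x).det) s := by
  simp only [Matrix.det_apply']
  refine ContDiffOn.sum fun σ _ => ?_
  refine contDiffOn_const.mul ?_
  exact contDiffOn_prod fun i _ => hA _ _

theorem contDiffOn_adjugate {ι V : Type*} [Fintype ι] [DecidableEq ι] [NormedAddCommGroup V]
    [NormedSpace ℝ V] {A : V → Matrix ι ι ℝ} {s : Set V} {n : WithTop ℕ∞}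
    (hA : ∀ i j, ContDiffOn ℝ n (fun x => A x i j) s) (i j : ι) :
    ContDiffOn ℝ n (fun x => (A x).adjugate i j) s := by
  simp only [Matrix.adjugate_apply]
  refine contDiffOn_det fun a b => ?_
  by_cases h : a = j
  · subst h
    simpa using contDiffOn_const
  · simpa [Matrix.updateRow_apply, h] using hA a b

/-- A cubic form that vanishes identically has vanishing polarization. -/
theorem polarization_eq_zero {V W : Type*} [NormedAddCommGroup V] [NormedSpace ℝ V]
    [NormedAddCommGroup W] [NormedSpace ℝ W] (M : V →L[ℝ] V →L[ℝ] V →L[ℝ] W)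
    (hM : ∀ v, M v v v = 0) (v w : V) : M v v w + M v w v + M w v v = 0 := by
  -- Subtracting the values at `v + w` and `v - w` keeps the terms odd in `w`: twice the wanted sum
  -- plus twice `M w w w`, which is zero.
  have h1 := hM (v + w)
  have h2 := hM (v - w)
  have h3 := hM w
  have h4 := hM v
  simp only [map_add, map_sub, add_apply, sub_apply] at h1 h2
  have h5 : (2 : ℝ) • (M v v w + M v w v + M w v v) = 0 := by
    rw [two_smul]
    rw [h3, h4] at h1 h2
    have := congrArg₂ (· - ·) h1 h2
    simp only [sub_zero] at this
    rw [← this]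
    abel
  exact (smul_eq_zero.1 h5).resolve_left two_ne_zero

/-- Second order Taylor formula with a remainder bounded by the cube of the norm. -/
theorem taylor_two_bound {V : Type*} [NormedAddCommGroup V] [NormedSpace ℝ V]
    {f : V → ℝ} (hf : ContDiffAt ℝ 3 f 0) :
    ∃ C r : ℝ, 0 < r ∧ ∀ v : V, ‖v‖ < r →
      |f v - f 0 - fderiv ℝ f 0 v - 1 / 2 * fderiv ℝ (fderiv ℝ f) 0 v v| ≤ C * ‖v‖ ^ 3 := by
  have hf1 : ContDiffAt ℝ 2 (fderiv ℝ f) 0 := hf.fderiv_right (by norm_num)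
  have hf2 : ContDiffAt ℝ 1 (fderiv ℝ (fderiv ℝ f)) 0 := hf1.fderiv_right (by norm_num)
  -- The second derivative is Lipschitz near 0. Two applications of the mean value inequality on the
  -- closed ball of radius `‖v‖` then cost one factor `‖v‖` each; the sharp constant is not needed.
  obtain ⟨K, s, hs, hK⟩ := hf2.exists_lipschitzOnWith
  have hd0 : ∀ᶠ x in 𝓝 (0 : V), DifferentiableAt ℝ f x :=
    (hf.eventually (by simp)).mono fun x hx => hx.differentiableAt (by norm_num)
  have hd1 : ∀ᶠ x in 𝓝 (0 : V), DifferentiableAt ℝ (fderiv ℝ f) x :=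
    (hf1.eventually (by simp)).mono fun x hx => hx.differentiableAt (by norm_num)
  obtain ⟨r, hr, hball⟩ := Metric.eventually_nhds_iff_ball.1
    ((show ∀ᶠ x in 𝓝 (0 : V), x ∈ s from hs).and (hd0.and hd1))
  have h0s : (0 : V) ∈ s := (hball 0 (Metric.mem_ball_self hr)).1
  set H := fderiv ℝ (fderiv ℝ f) 0 with hH
  have hHsymm : ∀ u w, H u w = H w u := fun u w =>
    (hf.isSymmSndFDerivAt (by simp; norm_num)).eq u w
  have hfderiv : ∀ v : V, ‖v‖ < r → ‖fderiv ℝ f v - fderiv ℝ f 0 - H v‖ ≤ K * ‖v‖ * ‖v‖ := by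
    intro v hv
    have hsub : Metric.closedBall (0 : V) ‖v‖ ⊆ Metric.ball 0 r := Metric.closedBall_subset_ball hv
    have := (convex_closedBall (0 : V) ‖v‖).norm_image_sub_le_of_norm_hasFDerivWithin_le
      (f := fun x => fderiv ℝ f x - H x) (f' := fun x => fderiv ℝ (fderiv ℝ f) x - H)
      (C := K * ‖v‖) (x := 0) (y := v)
      (fun x hx => by
        have hx' := (hball x (hsub hx)).2.2.hasFDerivAt
        exact (hx'.sub H.hasFDerivAt).hasFDerivWithinAt)
      (fun x hx => by
        have := hK.dist_le_mul x (hball x (hsub hx)).1 0 h0s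
        rw [dist_eq_norm, dist_zero_right] at this
        refine this.trans ?_
        gcongr
        simpa using hx)
      (by simp) (by simp)
    simpa [sub_right_comm] using this
  refine ⟨K, r, hr, fun v hv => ?_⟩
  have hsub : Metric.closedBall (0 : V) ‖v‖ ⊆ Metric.ball 0 r := Metric.closedBall_subset_ball hv
  have := (convex_closedBall (0 : V) ‖v‖).norm_image_sub_le_of_norm_hasFDerivWithin_le
      (f := fun x => f x - fderiv ℝ f 0 x - 1 / 2 * H x x)
      (f' := fun x => fderiv ℝ f x - fderiv ℝ f 0 - H x)
      (C := K * ‖v‖ * ‖v‖) (x := 0) (y := v)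
      (fun x hx => by
        have hx' := (hball x (hsub hx)).2.1.hasFDerivAt
        have hq : HasFDerivAt (fun x => 1 / 2 * H x x) (H x) x := by
          have := (H.hasFDerivAt.clm_apply (hasFDerivAt_id x)).const_mul (1 / 2 : ℝ)
          refine this.congr_fderiv ?_
          ext u
          simp [hHsymm u x]
          ring
        exact ((hx'.sub (fderiv ℝ f 0).hasFDerivAt).sub hq).hasFDerivWithinAt)
      (fun x hx => by
        have hx2 : ‖x‖ ≤ ‖v‖ := by simpa using hx
        refine (hfderiv x (hx2.trans_lt hv)).trans ?_
        gcongr)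
      (by simp) (by simp)
  simp only [map_zero, sub_zero, mul_zero, Real.norm_eq_abs] at this
  have he : f v - f 0 - fderiv ℝ f 0 v - 1 / 2 * H v v
      = f v - fderiv ℝ f 0 v - 1 / 2 * H v v - f 0 := by ring
  rw [he]
  calc _ ≤ _ := this
    _ = _ := by ring

/-! ### Christoffel symbols and curvature in coordinates -/

section Metric

variable {n : ℕ} {U : Set (Fin n → ℝ)} {g : (Fin n → ℝ) → Matrix (Fin n) (Fin n) ℝ}

theorem fderiv_apply_eq_sum {W : Type*} [NormedAddCommGroup W] [NormedSpace ℝ W]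
    (L : (Fin n → ℝ) →L[ℝ] W) (u : Fin n → ℝ) : L u = ∑ k, u k • L (Pi.single k 1) := by
  conv_lhs => rw [pi_eq_sum_univ' u]
  rw [map_sum]
  simp only [map_smul]

theorem contDiffOn_pderiv {f : (Fin n → ℝ) → ℝ} (hU : IsOpen U) (hf : ContDiffOn ℝ ∞ f U)
    (k : Fin n) : ContDiffOn ℝ ∞ (pderiv k f) U :=
  (hf.fderiv_of_isOpen hU (by simp)).clm_apply contDiffOn_const

theorem pderiv_pderiv {f : (Fin n → ℝ) → ℝ} {x : Fin n → ℝ} (hf : ContDiffAt ℝ 2 f x)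
    (i j : Fin n) : pderiv i (pderiv j f) x
      = fderiv ℝ (fderiv ℝ f) x (Pi.single i 1) (Pi.single j 1) := by
  have hd : DifferentiableAt ℝ (fderiv ℝ f) x :=
    (hf.fderiv_right (m := 1) (by norm_num)).differentiableAt (by norm_num)
  have := (hd.hasFDerivAt.clm_apply (hasFDerivAt_const (Pi.single j (1 : ℝ)) x)).fderiv
  change fderiv ℝ (fun y => fderiv ℝ f y (Pi.single j 1)) x (Pi.single i 1) = _
  rw [this]
  simp

theorem pderiv_comm {f : (Fin n → ℝ) → ℝ} {x : Fin n → ℝ} (hf : ContDiffAt ℝ 2 f x)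
    (i j : Fin n) : pderiv i (pderiv j f) x = pderiv j (pderiv i f) x := by
  rw [pderiv_pderiv hf, pderiv_pderiv hf, (hf.isSymmSndFDerivAt (by simp)).eq]

namespace IsRiemannianMetric

variable (hg : IsRiemannianMetric U g)
include hg

theorem symm {x : Fin n → ℝ} (hx : x ∈ U) (i j : Fin n) : g x i j = g x j i := by
  have := (hg.posDef x hx).isHermitian.apply j i
  simpa using this

theorem det_pos {x : Fin n → ℝ} (hx : x ∈ U) : 0 < (g x).det := (hg.posDef x hx).det_pos

theorem inv_symm {x : Fin n → ℝ} (hx : x ∈ U) (i j : Fin n) : (g x)⁻¹ i j = (g x)⁻¹ j i := by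
  have := (hg.posDef x hx).inv.isHermitian.apply j i
  simpa using this

theorem mul_inv {x : Fin n → ℝ} (hx : x ∈ U) : g x * (g x)⁻¹ = 1 :=
  Matrix.mul_nonsing_inv _ (hg.det_pos hx).ne'.isUnit

theorem inv_mul {x : Fin n → ℝ} (hx : x ∈ U) : (g x)⁻¹ * g x = 1 :=
  Matrix.nonsing_inv_mul _ (hg.det_pos hx).ne'.isUnit

theorem contDiffOn_inv (i j : Fin n) : ContDiffOn ℝ ∞ (fun x => (g x)⁻¹ i j) U := by
  have h : ∀ x, (g x)⁻¹ i j = ((g x).det)⁻¹ * (g x).adjugate i j := by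
    intro x
    rw [Matrix.inv_def]
    simp
  simp only [h]
  exact ((contDiffOn_det hg.smooth).inv fun x hx => (hg.det_pos hx).ne').mul
    (contDiffOn_adjugate hg.smooth i j)

theorem contDiffOn_christoffel (hU : IsOpen U) (k i j : Fin n) :
    ContDiffOn ℝ ∞ (fun x => christoffel g x k i j) U := by
  unfold christoffel
  refine ContDiffOn.sum fun m _ => ?_
  refine ((hg.contDiffOn_inv k m).mul contDiffOn_const).mul ?_
  exact ((contDiffOn_pderiv hU (hg.smooth _ _) _).add (contDiffOn_pderiv hU (hg.smooth _ _) _)).sub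
    (contDiffOn_pderiv hU (hg.smooth _ _) _)

theorem pderiv_symm (hU : IsOpen U) {x : Fin n → ℝ} (hx : x ∈ U) (k i j : Fin n) :
    pderiv k (fun y => g y i j) x = pderiv k (fun y => g y j i) x := by
  unfold pderiv
  rw [Filter.EventuallyEq.fderiv_eq]
  filter_upwards [hU.mem_nhds hx] with y hy
  exact hg.symm hy i j

theorem christoffel_symm (hU : IsOpen U) {x : Fin n → ℝ} (hx : x ∈ U) (k i j : Fin n) :
    christoffel g x k i j = christoffel g x k j i := by
  unfold christoffel
  refine Finset.sum_congr rfl fun m _ => ?_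
  rw [hg.pderiv_symm hU hx m i j]
  ring

/-- The Christoffel symbols of the first kind. -/
theorem sum_mul_christoffel {x : Fin n → ℝ} (hx : x ∈ U) (l i j : Fin n) :
    ∑ k, g x l k * christoffel g x k i j = 1 / 2 *
      (pderiv j (fun y => g y i l) x + pderiv i (fun y => g y j l) x
        - pderiv l (fun y => g y i j) x) := by
  set w : Fin n → ℝ := fun m => 1 / 2 *
      (pderiv j (fun y => g y i m) x + pderiv i (fun y => g y j m) x
        - pderiv m (fun y => g y i j) x) with hw
  have h : (fun k => christoffel g x k i j) = (g x)⁻¹ *ᵥ w := by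
    funext k
    simp only [christoffel, Matrix.mulVec, dotProduct, hw, mul_assoc]
  calc _ = (g x *ᵥ fun k => christoffel g x k i j) l := rfl
    _ = w l := by rw [h, Matrix.mulVec_mulVec, hg.mul_inv hx, Matrix.one_mulVec]

/-- Metric compatibility of the Levi-Civita connection. -/
theorem pderiv_eq (hU : IsOpen U) {x : Fin n → ℝ} (hx : x ∈ U) (k i j : Fin n) :
    pderiv k (fun y => g y i j) x
      = ∑ a, g x j a * christoffel g x a k i + ∑ a, g x i a * christoffel g x a k j := by
  rw [hg.sum_mul_christoffel hx, hg.sum_mul_christoffel hx, hg.pderiv_symm hU hx i k j,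
    hg.pderiv_symm hU hx j k i, hg.pderiv_symm hU hx k j i]
  ring

/-- The contraction `Γⁱ_{ij} = ½ g^{ia} ∂_j g_{ia}`. -/
theorem sum_christoffel (hU : IsOpen U) {x : Fin n → ℝ} (hx : x ∈ U) (j : Fin n) :
    ∑ i, christoffel g x i i j
      = 1 / 2 * ∑ i, ∑ a, (g x)⁻¹ i a * pderiv j (fun y => g y a i) x := by
  -- The last two terms of the Christoffel symbol become antisymmetric in the summed indices and
  -- cancel against the symmetric inverse metric.
  have h1 : ∑ i, ∑ a, (g x)⁻¹ i a * pderiv i (fun y => g y j a) x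
      = ∑ i, ∑ a, (g x)⁻¹ i a * pderiv a (fun y => g y i j) x := by
    rw [Finset.sum_comm]
    refine Finset.sum_congr rfl fun i _ => Finset.sum_congr rfl fun a _ => ?_
    rw [hg.inv_symm hx, hg.pderiv_symm hU hx a j i]
  have h2 : ∑ i, christoffel g x i i j = 1 / 2 * (∑ i, ∑ a, (g x)⁻¹ i a * pderiv j (fun y => g y a i) x
      + ∑ i, ∑ a, (g x)⁻¹ i a * pderiv i (fun y => g y j a) x
      - ∑ i, ∑ a, (g x)⁻¹ i a * pderiv a (fun y => g y i j) x) := by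
    simp only [christoffel, ← Finset.sum_add_distrib, ← Finset.sum_sub_distrib, Finset.mul_sum]
    refine Finset.sum_congr rfl fun i _ => Finset.sum_congr rfl fun a _ => ?_
    rw [hg.pderiv_symm hU hx j i a]
    ring
  rw [h2, h1]
  ring

/-- The curvature tensor in terms of the derivatives of the Christoffel symbols. -/
theorem curvature_eq (hU : IsOpen U) {x : Fin n → ℝ} (hx : x ∈ U) (i j k l : Fin n) :
    curvature g x i j k l = ∑ a, g x l a *
      (pderiv j (fun y => christoffel g y a i k) x - pderiv i (fun y => christoffel g y a j k) x
        + ∑ b, christoffel g x a j b * christoffel g x b i k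
        - ∑ b, christoffel g x a i b * christoffel g x b j k) := by
  have hd : ∀ {f : (Fin n → ℝ) → ℝ}, ContDiffOn ℝ ∞ f U → DifferentiableAt ℝ f x := fun hf =>
    (hf.contDiffAt (hU.mem_nhds hx)).differentiableAt (by simp)
  have hp : ∀ a b c, DifferentiableAt ℝ (pderiv a fun y => g y b c) x := fun a b c =>
    hd (contDiffOn_pderiv hU (hg.smooth b c) a)
  have hc : ∀ a b c, DifferentiableAt ℝ (fun y => christoffel g y a b c) x := fun a b c =>
    hd (hg.contDiffOn_christoffel hU a b c)
  have hcomm : ∀ a b c d, pderiv a (pderiv b fun y => g y c d) x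
      = pderiv b (pderiv a fun y => g y c d) x := fun a b c d =>
    pderiv_comm (((hg.smooth c d).contDiffAt (hU.mem_nhds hx)).of_le (by norm_cast)) a b
  -- derivative of the lowered symbols
  have key : ∀ r p q, ∑ a, g x l a * pderiv r (fun y => christoffel g y a p q) x
      = 1 / 2 * (pderiv r (pderiv q fun y => g y p l) x + pderiv r (pderiv p fun y => g y q l) x
        - pderiv r (pderiv l fun y => g y p q) x)
        - ∑ a, pderiv r (fun y => g y l a) x * christoffel g x a p q := by
    intro r p q
    have h1 : pderiv r (fun y => ∑ a, g y l a * christoffel g y a p q) x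
        = pderiv r (fun y => 1 / 2 *
      (pderiv q (fun y => g y p l) y + pderiv p (fun y => g y q l) y
        - pderiv l (fun y => g y p q) y)) x := by
      unfold pderiv
      rw [Filter.EventuallyEq.fderiv_eq]
      filter_upwards [hU.mem_nhds hx] with y hy
      exact hg.sum_mul_christoffel hy l p q
    have h2 : pderiv r (fun y => ∑ a, g y l a * christoffel g y a p q) x
        = ∑ a, (g x l a * pderiv r (fun y => christoffel g y a p q) x
          + pderiv r (fun y => g y l a) x * christoffel g x a p q) := by
      have := HasFDerivAt.fun_sum (u := Finset.univ) fun a _ =>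
        (hd (hg.smooth l a)).hasFDerivAt.fun_mul (hc a p q).hasFDerivAt
      have := congrArg (fun L => L (Pi.single r 1)) this.fderiv
      simpa [pderiv, mul_comm] using this
    have h3 : pderiv r (fun y => 1 / 2 *
      (pderiv q (fun y => g y p l) y + pderiv p (fun y => g y q l) y
        - pderiv l (fun y => g y p q) y)) x
        = 1 / 2 * (pderiv r (pderiv q fun y => g y p l) x + pderiv r (pderiv p fun y => g y q l) x
        - pderiv r (pderiv l fun y => g y p q) x) := by
      have := (((hp q p l).hasFDerivAt.add (hp p q l).hasFDerivAt).sub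
        (hp l p q).hasFDerivAt).const_mul (1 / 2 : ℝ)
      have := congrArg (fun L => L (Pi.single r 1)) this.fderiv
      simpa [pderiv] using this
    rw [← h3, ← h1, h2, Finset.sum_add_distrib]
    ring
  -- Metric compatibility splits ∂g·Γ in two. The first part is the quadratic term in the definition
  -- of the curvature; the second cancels the quadratic terms of the right-hand side of the lemma.
  have hprod : ∀ r p q, ∑ a, pderiv r (fun y => g y l a) x * christoffel g x a p q
      = ∑ a, ∑ b, g x a b * (christoffel g x b r l * christoffel g x a p q)
        + ∑ a, g x l a * ∑ b, christoffel g x a r b * christoffel g x b p q := by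
    intro r p q
    simp only [hg.pderiv_eq hU hx, add_mul, Finset.sum_add_distrib, Finset.sum_mul, Finset.mul_sum]
    congr 1
    · refine Finset.sum_congr rfl fun a _ => Finset.sum_congr rfl fun b _ => ?_
      ring
    · rw [Finset.sum_comm]
      refine Finset.sum_congr rfl fun a _ => Finset.sum_congr rfl fun b _ => ?_
      ring
  simp only [mul_add, mul_sub, Finset.sum_add_distrib, Finset.sum_sub_distrib, key, hprod]
  have hswap : ∀ r p q, ∑ a, ∑ b, g x a b * (christoffel g x b r l * christoffel g x a p q)
      = ∑ a, ∑ b, g x a b * (christoffel g x a r l * christoffel g x b p q) := by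
    intro r p q
    rw [Finset.sum_comm]
    refine Finset.sum_congr rfl fun a _ => Finset.sum_congr rfl fun b _ => ?_
    rw [hg.symm hx]
  simp only [hswap, curvature, mul_sub, Finset.sum_sub_distrib]
  -- The mixed derivatives of `g k l` occur with opposite signs and in opposite orders; the other
  -- second derivatives already match.
  rw [hcomm j i k l]
  ring

end IsRiemannianMetric

end Metric

theorem contDiffOn_smul_right {V W : Type*} [NormedAddCommGroup V] [NormedSpace ℝ V]
    [NormedAddCommGroup W] [NormedSpace ℝ W] {f : V → ℝ} {s : Set V} {k : WithTop ℕ∞}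
    (hf : ContDiffOn ℝ k f s) (c : W) : ContDiffOn ℝ k (fun x => f x • c) s :=
  hf.smul contDiffOn_const

/-! ### Metric, connection and Ricci form as multilinear maps -/

section Forms

variable {n : ℕ} {U : Set (Fin n → ℝ)} {g : (Fin n → ℝ) → Matrix (Fin n) (Fin n) ℝ}

/-- The continuous bilinear form of the scalar product at `x`. -/
def metricForm (g : (Fin n → ℝ) → Matrix (Fin n) (Fin n) ℝ) (x : Fin n → ℝ) :
    (Fin n → ℝ) →L[ℝ] (Fin n → ℝ) →L[ℝ] ℝ :=
  ∑ i, ∑ j, g x i j • (ContinuousLinearMap.proj (R := ℝ) (φ := fun _ : Fin n => ℝ) i).smulRight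
    (ContinuousLinearMap.proj (R := ℝ) (φ := fun _ : Fin n => ℝ) j)

/-- The continuous bilinear map `(u, w) ↦ Γᵏ_{ij} uⁱ wʲ`. -/
def connection (g : (Fin n → ℝ) → Matrix (Fin n) (Fin n) ℝ) (x : Fin n → ℝ) :
    (Fin n → ℝ) →L[ℝ] (Fin n → ℝ) →L[ℝ] (Fin n → ℝ) :=
  ∑ k, ∑ i, ∑ j, christoffel g x k i j •
    (ContinuousLinearMap.proj (R := ℝ) (φ := fun _ : Fin n => ℝ) i).smulRight
      ((ContinuousLinearMap.proj (R := ℝ) (φ := fun _ : Fin n => ℝ) j).smulRight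
        (Pi.single k (1 : ℝ) : Fin n → ℝ))

theorem metricForm_apply (x u w : Fin n → ℝ) : metricForm g x u w = pairing (g x) u w := by
  simp [metricForm, pairing, mul_assoc]

theorem connection_apply (x u w : Fin n → ℝ) (k : Fin n) :
    connection g x u w k = ∑ i, ∑ j, christoffel g x k i j * u i * w j := by
  simp only [connection, sum_apply, Finset.sum_apply, smul_apply,
    ContinuousLinearMap.smulRight_apply, ContinuousLinearMap.proj_apply, Pi.smul_apply,
    smul_eq_mul]
  rw [Finset.sum_eq_single k]
  · simp [mul_assoc]
  · intro b _ hb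
    simp [hb.symm]
  · simp

/-- The Ricci form `R_{ijkl} g^{jl} vⁱ vᵏ`. -/
def ricciForm (g : (Fin n → ℝ) → Matrix (Fin n) (Fin n) ℝ) (x v : Fin n → ℝ) : ℝ :=
  ∑ i, ∑ j, ∑ k, ∑ l, (g x)⁻¹ j l * curvature g x i j k l * v i * v k

namespace IsRiemannianMetric

variable (hg : IsRiemannianMetric U g)
include hg

theorem contDiffOn_metricForm : ContDiffOn ℝ ∞ (metricForm g) U := by
  unfold metricForm
  exact ContDiffOn.sum fun i _ => ContDiffOn.sum fun j _ =>
    contDiffOn_smul_right (hg.smooth i j) _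

theorem contDiffOn_connection (hU : IsOpen U) : ContDiffOn ℝ ∞ (connection g) U := by
  unfold connection
  exact ContDiffOn.sum fun k _ => ContDiffOn.sum fun i _ => ContDiffOn.sum fun j _ =>
    contDiffOn_smul_right (hg.contDiffOn_christoffel hU k i j) _

theorem metricForm_symm {x : Fin n → ℝ} (hx : x ∈ U) (u w : Fin n → ℝ) :
    metricForm g x u w = metricForm g x w u := by
  rw [metricForm_apply, metricForm_apply, pairing, pairing, Finset.sum_comm]
  refine Finset.sum_congr rfl fun i _ => Finset.sum_congr rfl fun j _ => ?_
  rw [hg.symm hx]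
  ring

theorem metricForm_pos {x : Fin n → ℝ} (hx : x ∈ U) {u : Fin n → ℝ} (hu : u ≠ 0) :
    0 < metricForm g x u u := by
  have := (hg.posDef x hx).dotProduct_mulVec_pos hu
  rw [metricForm_apply, pairing]
  refine this.trans_eq ?_
  simp only [dotProduct, Matrix.mulVec, Finset.mul_sum]
  refine Finset.sum_congr rfl fun i _ => Finset.sum_congr rfl fun j _ => ?_
  rw [Pi.star_apply, star_trivial]
  ring

theorem eq_zero_of_metricForm_eq_zero {x : Fin n → ℝ} (hx : x ∈ U) {u : Fin n → ℝ}
    (hu : ∀ w, metricForm g x u w = 0) : u = 0 := by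
  by_contra h
  exact (hg.metricForm_pos hx h).ne' (hu u)

theorem connection_symm (hU : IsOpen U) {x : Fin n → ℝ} (hx : x ∈ U) (u w : Fin n → ℝ) :
    connection g x u w = connection g x w u := by
  funext k
  rw [connection_apply, connection_apply, Finset.sum_comm]
  refine Finset.sum_congr rfl fun i _ => Finset.sum_congr rfl fun j _ => ?_
  rw [hg.christoffel_symm hU hx]
  ring

theorem hasFDerivAt_metricForm (hU : IsOpen U) {x : Fin n → ℝ} (hx : x ∈ U) :
    HasFDerivAt (metricForm g) (fderiv ℝ (metricForm g) x) x :=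
  ((hg.contDiffOn_metricForm.contDiffAt (hU.mem_nhds hx)).differentiableAt (by simp)).hasFDerivAt

theorem hasFDerivAt_connection (hU : IsOpen U) {x : Fin n → ℝ} (hx : x ∈ U) :
    HasFDerivAt (connection g) (fderiv ℝ (connection g) x) x :=
  (((hg.contDiffOn_connection hU).contDiffAt (hU.mem_nhds hx)).differentiableAt
    (by simp)).hasFDerivAt

theorem fderiv_metricForm_apply (hU : IsOpen U) {x : Fin n → ℝ} (hx : x ∈ U)
    (u a b : Fin n → ℝ) : fderiv ℝ (metricForm g) x u a b
      = ∑ k, ∑ i, ∑ j, u k * (pderiv k (fun y => g y i j) x * a i * b j) := by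
  have h1 : HasFDerivAt (fun y => metricForm g y a b)
      (∑ i, ∑ j, (a i * b j) • fderiv ℝ (fun y => g y i j) x) x := by
    simp only [metricForm_apply, pairing]
    refine HasFDerivAt.fun_sum fun i _ => HasFDerivAt.fun_sum fun j _ => ?_
    have hd := (((hg.smooth i j).contDiffAt (hU.mem_nhds hx)).differentiableAt
      (by simp)).hasFDerivAt
    simpa [mul_assoc, mul_comm (a i * b j)] using hd.const_mul (a i * b j)
  have h2 := ((hg.hasFDerivAt_metricForm hU hx).clm_apply (hasFDerivAt_const a x)).clm_apply
    (hasFDerivAt_const b x)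
  have h3 := congrArg (fun L => L u) (h2.unique h1)
  simp only [ContinuousLinearMap.comp_zero, zero_add, ContinuousLinearMap.flip_apply,
    sum_apply, smul_apply, smul_eq_mul] at h3
  rw [h3]
  simp only [fderiv_apply_eq_sum _ u, smul_eq_mul, Finset.mul_sum]
  rw [Finset.sum_congr rfl fun i _ => Finset.sum_comm, Finset.sum_comm]
  refine Finset.sum_congr rfl fun k _ => Finset.sum_congr rfl fun i _ =>
    Finset.sum_congr rfl fun j _ => ?_
  rw [pderiv]
  ring

/-- Metric compatibility of the connection. -/
theorem fderiv_metricForm (hU : IsOpen U) {x : Fin n → ℝ} (hx : x ∈ U) (u a b : Fin n → ℝ) :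
    fderiv ℝ (metricForm g) x u a b
      = metricForm g x (connection g x u a) b + metricForm g x a (connection g x u b) := by
  have h1 : metricForm g x (connection g x u a) b
      = ∑ k, ∑ i, ∑ j, u k * ((∑ l, g x j l * christoffel g x l k i) * a i * b j) := by
    rw [metricForm_apply, pairing]
    simp only [connection_apply, Finset.mul_sum, Finset.sum_mul]
    rw [Finset.sum_comm' (s := Finset.univ) (t' := Finset.univ) (s' := fun _ => Finset.univ)
      (by simp)]
    rw [Finset.sum_congr rfl fun j _ => Finset.sum_comm]
    rw [Finset.sum_congr rfl fun j _ => Finset.sum_congr rfl fun k _ => Finset.sum_comm]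
    rw [Finset.sum_comm, Finset.sum_congr rfl fun k _ => Finset.sum_comm]
    refine Finset.sum_congr rfl fun k _ => Finset.sum_congr rfl fun i _ =>
      Finset.sum_congr rfl fun j _ => Finset.sum_congr rfl fun l _ => ?_
    rw [hg.symm hx j l]
    ring
  have h2 : metricForm g x a (connection g x u b)
      = ∑ k, ∑ i, ∑ j, u k * ((∑ l, g x i l * christoffel g x l k j) * a i * b j) := by
    rw [metricForm_apply, pairing]
    simp only [connection_apply, Finset.mul_sum, Finset.sum_mul]
    rw [Finset.sum_congr rfl fun j _ => Finset.sum_comm, Finset.sum_comm]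
    rw [Finset.sum_congr rfl fun k _ => Finset.sum_congr rfl fun i _ => Finset.sum_comm]
    refine Finset.sum_congr rfl fun k _ => Finset.sum_congr rfl fun i _ =>
      Finset.sum_congr rfl fun j _ => Finset.sum_congr rfl fun l _ => ?_
    ring
  rw [hg.fderiv_metricForm_apply hU hx, h1, h2]
  simp only [← Finset.sum_add_distrib]
  refine Finset.sum_congr rfl fun k _ => Finset.sum_congr rfl fun i _ =>
      Finset.sum_congr rfl fun j _ => ?_
  rw [hg.pderiv_eq hU hx]
  ring

theorem fderiv_connection_apply (hU : IsOpen U) {x : Fin n → ℝ} (hx : x ∈ U)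
    (u a b : Fin n → ℝ) (m : Fin n) : fderiv ℝ (connection g) x u a b m
      = ∑ i, ∑ j, fderiv ℝ (fun y => christoffel g y m i j) x u * a i * b j := by
  have h1 : HasFDerivAt (fun y => connection g y a b m)
      (∑ i, ∑ j, (a i * b j) • fderiv ℝ (fun y => christoffel g y m i j) x) x := by
    simp only [connection_apply]
    refine HasFDerivAt.fun_sum fun i _ => HasFDerivAt.fun_sum fun j _ => ?_
    have hd := (((hg.contDiffOn_christoffel hU m i j).contDiffAt
      (hU.mem_nhds hx)).differentiableAt (by simp)).hasFDerivAt
    simpa [mul_assoc, mul_comm (a i * b j)] using hd.const_mul (a i * b j)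
  have h2 := hasFDerivAt_pi'.1 (((hg.hasFDerivAt_connection hU hx).clm_apply
    (hasFDerivAt_const a x)).clm_apply (hasFDerivAt_const b x)) m
  have h3 := congrArg (fun L => L u) (h2.unique h1)
  simp only [ContinuousLinearMap.comp_zero, zero_add, ContinuousLinearMap.flip_apply,
    sum_apply, smul_apply, smul_eq_mul, ContinuousLinearMap.comp_apply,
    ContinuousLinearMap.proj_apply] at h3
  rw [h3]
  refine Finset.sum_congr rfl fun i _ => Finset.sum_congr rfl fun j _ => ?_
  ring

/-- The Ricci form as a trace of the curvature operator of the connection. -/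
theorem ricciForm_eq (hU : IsOpen U) {x : Fin n → ℝ} (hx : x ∈ U) (v : Fin n → ℝ) :
    ricciForm g x v = ∑ j, (fderiv ℝ (connection g) x (Pi.single j 1) v v
      - fderiv ℝ (connection g) x v (Pi.single j 1) v
      + connection g x (Pi.single j 1) (connection g x v v)
      - connection g x v (connection g x (Pi.single j 1) v)) j := by
  have h1 : ∀ i j k, ∑ l, (g x)⁻¹ j l * curvature g x i j k l
      = pderiv j (fun y => christoffel g y j i k) x - pderiv i (fun y => christoffel g y j j k) x
        + ∑ b, christoffel g x j j b * christoffel g x b i k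
        - ∑ b, christoffel g x j i b * christoffel g x b j k := by
    intro i j k
    set w : Fin n → ℝ := fun a =>
      pderiv j (fun y => christoffel g y a i k) x - pderiv i (fun y => christoffel g y a j k) x
        + ∑ b, christoffel g x a j b * christoffel g x b i k
        - ∑ b, christoffel g x a i b * christoffel g x b j k with hw
    have h : (fun l => curvature g x i j k l) = g x *ᵥ w := by
      funext l
      rw [hg.curvature_eq hU hx]
      rfl
    calc _ = ((g x)⁻¹ *ᵥ fun l => curvature g x i j k l) j := rfl
      _ = w j := by rw [h, Matrix.mulVec_mulVec, hg.inv_mul hx, Matrix.one_mulVec]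
  have h2 : ricciForm g x v = ∑ j, ∑ i, ∑ k,
      (pderiv j (fun y => christoffel g y j i k) x - pderiv i (fun y => christoffel g y j j k) x
        + ∑ b, christoffel g x j j b * christoffel g x b i k
        - ∑ b, christoffel g x j i b * christoffel g x b j k) * v i * v k := by
    unfold ricciForm
    simp only [← Finset.sum_mul, h1]
    rw [Finset.sum_comm]
  rw [h2]
  refine Finset.sum_congr rfl fun j _ => ?_
  simp only [Pi.sub_apply, Pi.add_apply, hg.fderiv_connection_apply hU hx, connection_apply,
    sub_mul, add_mul, Finset.sum_add_distrib, Finset.sum_sub_distrib]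
  congr 1
  · congr 1
    · congr 1
      simp only [Pi.single_apply, mul_ite, mul_one, mul_zero, ite_mul, zero_mul]
      rw [Finset.sum_comm (f := fun i j_1 => if i = j then _ else _)]
      simp only [Finset.sum_ite_eq', Finset.mem_univ, if_true]
      simp only [fderiv_apply_eq_sum _ v, Finset.sum_mul, smul_eq_mul]
      rw [Finset.sum_comm]
      refine Finset.sum_congr rfl fun i _ => Finset.sum_congr rfl fun k _ => ?_
      rw [pderiv]
      ring
    · simp only [Pi.single_apply, mul_ite, mul_one, mul_zero, ite_mul, zero_mul]
      rw [Finset.sum_comm (f := fun i j_1 => if i = j then _ else _)]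
      simp only [Finset.sum_ite_eq', Finset.mem_univ, if_true, Finset.mul_sum, Finset.sum_mul]
      rw [Finset.sum_congr rfl fun i _ => Finset.sum_comm, Finset.sum_comm]
      refine Finset.sum_congr rfl fun i _ => Finset.sum_congr rfl fun k _ =>
        Finset.sum_congr rfl fun l _ => ?_
      ring
  · simp only [Pi.single_apply, mul_ite, mul_one, mul_zero, ite_mul, zero_mul]
    refine Finset.sum_congr rfl fun i _ => ?_
    simp only [Finset.mul_sum, Finset.sum_mul]
    rw [Finset.sum_comm]
    refine Finset.sum_congr rfl fun k _ => ?_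
    rw [Finset.sum_comm]
    simp only [mul_ite, mul_zero, Finset.sum_ite_eq', Finset.mem_univ, if_true]
    refine Finset.sum_congr rfl fun l _ => ?_
    ring

end IsRiemannianMetric

end Forms

/-! ### The third order jet of the exponential map at the origin -/

section Exponential

variable {n : ℕ} {U : Set (Fin n → ℝ)} {g : (Fin n → ℝ) → Matrix (Fin n) (Fin n) ℝ}
  {x₀ : Fin n → ℝ} {δ : ℝ} {E : (Fin n → ℝ) → (Fin n → ℝ)}

theorem hasDerivAt_ray {V W : Type*} [NormedAddCommGroup V] [NormedSpace ℝ V]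
    [NormedAddCommGroup W] [NormedSpace ℝ W] {f : V → W} {v : V} {t : ℝ}
    (hf : DifferentiableAt ℝ f (t • v)) :
    HasDerivAt (fun s : ℝ => f (s • v)) (fderiv ℝ f (t • v) v) t := by
  have h : HasDerivAt (fun s : ℝ => s • v) v t := by
    simpa using (hasDerivAt_id t).smul_const v
  exact hf.hasFDerivAt.comp_hasDerivAt t h

theorem isOpen_tangentBall : IsOpen (tangentBall g x₀ δ) := by
  refine isOpen_lt ?_ continuous_const
  simp only [← metricForm_apply]
  fun_prop

theorem zero_mem_tangentBall (hδ : 0 < δ) : (0 : Fin n → ℝ) ∈ tangentBall g x₀ δ := by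
  simp [tangentBall, ← metricForm_apply, hδ]

theorem IsRiemannianMetric.metricForm_nonneg (hg : IsRiemannianMetric U g) {x : Fin n → ℝ}
    (hx : x ∈ U) (u : Fin n → ℝ) : 0 ≤ metricForm g x u u := by
  rcases eq_or_ne u 0 with rfl | h
  · simp
  · exact (hg.metricForm_pos hx h).le

theorem IsRiemannianMetric.smul_mem_tangentBall (hg : IsRiemannianMetric U g) (hx₀ : x₀ ∈ U)
    {v : Fin n → ℝ} (hv : v ∈ tangentBall g x₀ δ) {s : ℝ} (hs : s ∈ Icc (0 : ℝ) 1) :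
    s • v ∈ tangentBall g x₀ δ := by
  have h0 := hg.metricForm_nonneg hx₀ v
  simp only [tangentBall, mem_ofPred_eq, ← metricForm_apply, map_smul, smul_apply,
    smul_eq_mul] at hv ⊢
  have : s * s ≤ 1 := mul_le_one₀ hs.2 hs.1 hs.2
  nlinarith

/-- Lets an identity homogeneous in `v` pass from the ball to all vectors: scale into the ball, then
cancel a power of the nonzero factor. -/
theorem exists_smul_mem_tangentBall (hδ : 0 < δ) (v : Fin n → ℝ) :
    ∃ s : ℝ, s ≠ 0 ∧ s • v ∈ tangentBall g x₀ δ := by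
  have hc : Tendsto (fun s : ℝ => s • v) (𝓝[≠] 0) (𝓝 0) := by
    have : Continuous fun s : ℝ => s • v := by fun_prop
    simpa using (this.tendsto 0).mono_left nhdsWithin_le_nhds
  have h1 := hc.eventually (isOpen_tangentBall.mem_nhds (zero_mem_tangentBall (g := g) (x₀ := x₀) hδ))
  obtain ⟨s, hs, hs0⟩ := (h1.and self_mem_nhdsWithin).exists
  exact ⟨s, hs0, hs⟩

/-- The covariant derivative `w ↦ D_u (DE w)` of the differential of `E` at `v`. -/
def covDeriv (g : (Fin n → ℝ) → Matrix (Fin n) (Fin n) ℝ) (E : (Fin n → ℝ) → (Fin n → ℝ))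
    (v u : Fin n → ℝ) : (Fin n → ℝ) →L[ℝ] (Fin n → ℝ) :=
  fderiv ℝ (fderiv ℝ E) v u + (connection g (E v) (fderiv ℝ E v u)).comp (fderiv ℝ E v)

/-- The Riemannian Jacobian `|DE| √|g|` of the map `E`. -/
def expJacobian (g : (Fin n → ℝ) → Matrix (Fin n) (Fin n) ℝ) (E : (Fin n → ℝ) → (Fin n → ℝ))
    (v : Fin n → ℝ) : ℝ :=
  (fderiv ℝ E v).det * √(g (E v)).det

theorem det_eq_det_toMatrix (L : (Fin n → ℝ) →L[ℝ] (Fin n → ℝ)) :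
    L.det = (LinearMap.toMatrix' (L : (Fin n → ℝ) →ₗ[ℝ] (Fin n → ℝ))).det := by
  rw [LinearMap.det_toMatrix']

theorem IsRiemannianMetric.hasDerivAt_sqrt_det (hg : IsRiemannianMetric U g) (hU : IsOpen U)
    {c : ℝ → Fin n → ℝ} {w : Fin n → ℝ} {t : ℝ} (hc : HasDerivAt c w t) (hct : c t ∈ U) :
    HasDerivAt (fun s => √(g (c s)).det)
      (√(g (c t)).det * ∑ i, connection g (c t) w (Pi.single i 1) i) t := by
  have h1 : HasDerivAt (fun s => (g (c s)).det) ((g (c t)).adjugate *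
      (Matrix.of fun i j => fderiv ℝ (fun y => g y i j) (c t) w)).trace t := by
    refine hasDerivAt_det fun i j => ?_
    exact (((hg.smooth i j).contDiffAt (hU.mem_nhds hct)).differentiableAt
      (by simp)).hasFDerivAt.comp_hasDerivAt t hc
  have hdet := hg.det_pos hct
  have h2 := h1.sqrt hdet.ne'
  convert h2 using 1
  have hadj : (g (c t)).adjugate = (g (c t)).det • (g (c t))⁻¹ := by
    rw [Matrix.inv_def, smul_smul, Ring.inverse_eq_inv', mul_inv_cancel₀ hdet.ne', one_smul]
  have h3 : ∑ i, connection g (c t) w (Pi.single i 1) i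
      = ∑ j, w j * ∑ i, christoffel g (c t) i i j := by
    simp only [connection_apply, Finset.mul_sum]
    rw [Finset.sum_comm]
    refine Finset.sum_congr rfl fun j _ => Finset.sum_congr rfl fun i _ => ?_
    simp only [Pi.single_apply, mul_ite, mul_one, mul_zero, Finset.sum_ite_eq', Finset.mem_univ,
      if_true]
    rw [hg.christoffel_symm hU hct, mul_comm]
  rw [hadj, h3]
  simp only [hg.sum_christoffel hU hct, Matrix.trace, Matrix.smul_mul, Matrix.diag_apply,
    Matrix.smul_apply, Matrix.mul_apply, Matrix.of_apply, smul_eq_mul]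
  rw [eq_div_iff (by positivity)]
  have h4 : ∑ i, ∑ a, (g (c t))⁻¹ i a * fderiv ℝ (fun y => g y a i) (c t) w
      = ∑ j, w j * ∑ i, ∑ a, (g (c t))⁻¹ i a * pderiv j (fun y => g y a i) (c t) := by
    simp only [fderiv_apply_eq_sum _ w, Finset.mul_sum, smul_eq_mul]
    rw [Finset.sum_congr rfl fun i _ => Finset.sum_comm, Finset.sum_comm]
    refine Finset.sum_congr rfl fun j _ => Finset.sum_congr rfl fun i _ =>
      Finset.sum_congr rfl fun a _ => ?_
    rw [pderiv]
    ring
  rw [← Finset.mul_sum, h4]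
  have h5 : ∀ j, w j * (1 / 2 * ∑ i, ∑ a, (g (c t))⁻¹ i a * pderiv j (fun y => g y a i) (c t))
      = 1 / 2 * (w j * ∑ i, ∑ a, (g (c t))⁻¹ i a * pderiv j (fun y => g y a i) (c t)) := by
    intro j
    ring
  simp only [h5, ← Finset.mul_sum]
  have h6 := Real.mul_self_sqrt hdet.le
  linear_combination (∑ j, w j * ∑ i, ∑ a, (g (c t))⁻¹ i a * pderiv j (fun y => g y a i) (c t)) * h6

/-- The torsion-free symmetry holds on a neighbourhood of `x`, hence survives differentiation. -/
theorem IsRiemannianMetric.fderiv_connection_symm (hg : IsRiemannianMetric U g) (hU : IsOpen U)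
    {x : Fin n → ℝ} (hx : x ∈ U) (u a b : Fin n → ℝ) :
    fderiv ℝ (connection g) x u a b = fderiv ℝ (connection g) x u b a := by
  have h : ∀ a b, HasFDerivAt (fun y => connection g y a b)
      (((fderiv ℝ (connection g) x).flip a).flip b) x := by
    intro a b
    have := ((hg.hasFDerivAt_connection hU hx).clm_apply (hasFDerivAt_const a x)).clm_apply
      (hasFDerivAt_const b x)
    refine this.congr_fderiv ?_
    ext
    simp
  have h2 : (fun y => connection g y b a) =ᶠ[𝓝 x] fun y => connection g y a b := by
    filter_upwards [hU.mem_nhds hx] with y hy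
    exact hg.connection_symm hU hy b a
  have := congrArg (fun L => L u) ((h a b).unique ((h b a).congr_of_eventuallyEq h2.symm))
  simpa using this

namespace IsExponentialMap

variable (hU : IsOpen U) (hg : IsRiemannianMetric U g) (hx₀ : x₀ ∈ U) (hδ : 0 < δ)
  (hE : IsExponentialMap U g x₀ δ E)

include hE

theorem contDiffAt {v : Fin n → ℝ} (hv : v ∈ tangentBall g x₀ δ) : ContDiffAt ℝ ∞ E v :=
  hE.smooth.contDiffAt (isOpen_tangentBall.mem_nhds hv)

theorem contDiffOn_fderiv : ContDiffOn ℝ ∞ (fderiv ℝ E) (tangentBall g x₀ δ) :=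
  hE.smooth.fderiv_of_isOpen isOpen_tangentBall (by simp)

theorem contDiffOn_fderiv_fderiv :
    ContDiffOn ℝ ∞ (fderiv ℝ (fderiv ℝ E)) (tangentBall g x₀ δ) :=
  hE.contDiffOn_fderiv.fderiv_of_isOpen isOpen_tangentBall (by simp)

theorem differentiableAt {v : Fin n → ℝ} (hv : v ∈ tangentBall g x₀ δ) :
    DifferentiableAt ℝ E v := (hE.contDiffAt hv).differentiableAt (by simp)

theorem differentiableAt_fderiv {v : Fin n → ℝ} (hv : v ∈ tangentBall g x₀ δ) :
    DifferentiableAt ℝ (fderiv ℝ E) v :=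
  (hE.contDiffOn_fderiv.contDiffAt (isOpen_tangentBall.mem_nhds hv)).differentiableAt (by simp)

theorem differentiableAt_fderiv_fderiv {v : Fin n → ℝ} (hv : v ∈ tangentBall g x₀ δ) :
    DifferentiableAt ℝ (fderiv ℝ (fderiv ℝ E)) v :=
  (hE.contDiffOn_fderiv_fderiv.contDiffAt (isOpen_tangentBall.mem_nhds hv)).differentiableAt
    (by simp)

theorem fderiv_fderiv_symm {v : Fin n → ℝ} (hv : v ∈ tangentBall g x₀ δ) (u w : Fin n → ℝ) :
    fderiv ℝ (fderiv ℝ E) v u w = fderiv ℝ (fderiv ℝ E) v w u :=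
  ((hE.contDiffAt hv).isSymmSndFDerivAt (by simp; norm_cast)).eq u w

theorem mem {v : Fin n → ℝ} (hv : v ∈ tangentBall g x₀ δ) : E v ∈ U := hE.mapsTo hv

include hδ in
theorem fderiv_zero : fderiv ℝ E 0 = ContinuousLinearMap.id ℝ (Fin n → ℝ) := by
  ext1 v
  obtain ⟨s, hs, hsv⟩ := exists_smul_mem_tangentBall (g := g) (x₀ := x₀) hδ v
  have h0 := zero_mem_tangentBall (g := g) (x₀ := x₀) hδ
  have h1 := hE.velocity _ hsv
  have h2 := hasDerivAt_ray (f := E) (v := s • v) (t := 0) (by simpa using hE.differentiableAt h0)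
  rw [h2.deriv, zero_smul, map_smul] at h1
  exact smul_right_injective _ hs h1

include hg hx₀ in
/-- The geodesic equation of the radial curves. -/
theorem geodesic_eq {v : Fin n → ℝ} (hv : v ∈ tangentBall g x₀ δ) {s : ℝ}
    (hs : s ∈ Icc (0 : ℝ) 1) :
    fderiv ℝ (fderiv ℝ E) (s • v) v v
      + connection g (E (s • v)) (fderiv ℝ E (s • v) v) (fderiv ℝ E (s • v) v) = 0 := by
  have hsv := hg.smul_mem_tangentBall hx₀ hv hs
  have hev : ∀ᶠ t in 𝓝 s, t • v ∈ tangentBall g x₀ δ :=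
    (by fun_prop : Continuous fun t : ℝ => t • v).continuousAt.eventually
      (isOpen_tangentBall.mem_nhds hsv)
  have h1 : deriv (fun t : ℝ => E (t • v)) =ᶠ[𝓝 s] fun t => fderiv ℝ E (t • v) v := by
    filter_upwards [hev] with t ht
    exact (hasDerivAt_ray (hE.differentiableAt ht)).deriv
  have h2 : deriv (deriv fun t : ℝ => E (t • v)) s = fderiv ℝ (fderiv ℝ E) (s • v) v v := by
    rw [h1.deriv_eq]
    have := (hasDerivAt_ray (hE.differentiableAt_fderiv hsv)).clm_apply (hasDerivAt_const s v)
    simpa using this.deriv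
  funext k
  have := hE.geodesic v hv s hs k
  rw [h2, h1.eq_of_nhds] at this
  rw [Pi.add_apply, connection_apply]
  exact this

include hg hx₀ hδ hU in
-- The geodesic equation at the centre says that the symmetric bilinear map D²E(0) + Γ has zero
-- diagonal, so it vanishes by polarization.
theorem fderiv_fderiv_zero (u w : Fin n → ℝ) :
    fderiv ℝ (fderiv ℝ E) 0 u w = -connection g x₀ u w := by
  have h0 := zero_mem_tangentBall (g := g) (x₀ := x₀) hδ
  set B := fderiv ℝ (fderiv ℝ E) 0 + connection g x₀ with hB
  have h1 : ∀ v, B v v = 0 := by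
    intro v
    obtain ⟨s, hs, hsv⟩ := exists_smul_mem_tangentBall (g := g) (x₀ := x₀) hδ v
    have := hE.geodesic_eq hg hx₀ hsv (s := 0) (by simp)
    rw [zero_smul, hE.fderiv_zero hδ, hE.map_zero] at this
    have h3 : (s * s) • B v v = 0 := by
      rw [← this]
      simp [hB, mul_smul]
    exact (smul_eq_zero.1 h3).resolve_left (mul_self_ne_zero.2 hs)
  have hsymm : B u w = B w u := by
    simp only [hB, add_apply]
    rw [hE.fderiv_fderiv_symm h0, hg.connection_symm hU hx₀]
  have h2 := h1 (u + w)
  simp only [map_add, add_apply, h1, zero_add, add_zero] at h2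
  rw [hsymm, ← two_smul ℝ] at h2
  have h3 := (smul_eq_zero.1 h2).resolve_left two_ne_zero
  rw [← hsymm] at h3
  exact eq_neg_of_add_eq_zero_left h3

include hδ in
-- Symmetry of D²E near 0, differentiated. Together with the exchange of the first two slots it
-- makes D³E(0) totally symmetric, which the polarization below needs.
theorem fderiv_fderiv_fderiv_symm_right (a b c : Fin n → ℝ) :
    fderiv ℝ (fderiv ℝ (fderiv ℝ E)) 0 a b c = fderiv ℝ (fderiv ℝ (fderiv ℝ E)) 0 a c b := by
  have h0 := zero_mem_tangentBall (g := g) (x₀ := x₀) hδ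
  have h : ∀ b c, HasFDerivAt (fun y => fderiv ℝ (fderiv ℝ E) y b c)
      (((fderiv ℝ (fderiv ℝ (fderiv ℝ E)) 0).flip b).flip c) 0 := by
    intro b c
    have := ((hE.differentiableAt_fderiv_fderiv h0).hasFDerivAt.clm_apply
      (hasFDerivAt_const b 0)).clm_apply (hasFDerivAt_const c 0)
    refine this.congr_fderiv ?_
    ext
    simp
  have h2 : (fun y => fderiv ℝ (fderiv ℝ E) y c b) =ᶠ[𝓝 0]
      fun y => fderiv ℝ (fderiv ℝ E) y b c := by
    filter_upwards [isOpen_tangentBall.mem_nhds h0] with y hy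
    exact hE.fderiv_fderiv_symm hy c b
  have := congrArg (fun L => L a) ((h b c).unique ((h c b).congr_of_eventuallyEq h2.symm))
  simpa using this

include hδ in
theorem fderiv_fderiv_fderiv_symm_left (a b c : Fin n → ℝ) :
    fderiv ℝ (fderiv ℝ (fderiv ℝ E)) 0 a b c = fderiv ℝ (fderiv ℝ (fderiv ℝ E)) 0 b a c := by
  have h0 := zero_mem_tangentBall (g := g) (x₀ := x₀) hδ
  have := ((hE.contDiffOn_fderiv.contDiffAt (isOpen_tangentBall.mem_nhds h0)).isSymmSndFDerivAt
    (by simp; norm_cast)).eq a b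
  rw [this]

include hg hx₀ hδ hU in
/-- The derivative of the covariant derivative along a ray, at the origin. -/
theorem hasDerivAt_covDeriv (v w : Fin n → ℝ) :
    HasDerivAt (fun t : ℝ => covDeriv g E (t • v) v w)
      (fderiv ℝ (fderiv ℝ (fderiv ℝ E)) 0 v v w + fderiv ℝ (connection g) x₀ v v w
        - connection g x₀ (connection g x₀ v v) w - connection g x₀ v (connection g x₀ v w)) 0 := by
  have h0 : (0 : ℝ) • v ∈ tangentBall g x₀ δ := by
    simpa using zero_mem_tangentBall (g := g) (x₀ := x₀) hδ
  have hE0 : E ((0 : ℝ) • v) = x₀ := by simp [hE.map_zero]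
  have d2 := hasDerivAt_ray (f := fderiv ℝ (fderiv ℝ E)) (hE.differentiableAt_fderiv_fderiv h0)
  have d1 := hasDerivAt_ray (f := fderiv ℝ E) (hE.differentiableAt_fderiv h0)
  have dE := hasDerivAt_ray (f := E) (hE.differentiableAt h0)
  have dΓ : HasDerivAt (fun t : ℝ => connection g (E (t • v)))
      (fderiv ℝ (connection g) x₀ (fderiv ℝ E ((0 : ℝ) • v) v)) 0 := by
    have hc : HasFDerivAt (connection g) (fderiv ℝ (connection g) x₀) (E ((0 : ℝ) • v)) := by
      rw [hE0]
      exact hg.hasFDerivAt_connection hU hx₀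
    exact HasFDerivAt.comp_hasDerivAt (l := connection g) (l' := fderiv ℝ (connection g) x₀)
      (f := fun t : ℝ => E (t • v)) (0 : ℝ) hc dE
  have hv := hasDerivAt_const (0 : ℝ) v
  have hw := hasDerivAt_const (0 : ℝ) w
  have := ((d2.clm_apply hv).clm_apply hw).fun_add
    ((dΓ.clm_apply (d1.clm_apply hv)).clm_apply (d1.clm_apply hw))
  refine this.congr_deriv ?_
  simp only [zero_smul, _root_.map_zero, add_zero, neg_zero, hE.fderiv_zero hδ, hE.map_zero,
    add_apply, hE.fderiv_fderiv_zero hU hg hx₀ hδ, map_neg, neg_apply,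
    ContinuousLinearMap.id_apply]
  abel

include hg hx₀ hδ hU in
-- The Christoffel symbols of normal coordinates vanish at the centre: D²E(0) = -Γ cancels the
-- connection term.
theorem covDeriv_zero (v : Fin n → ℝ) : covDeriv g E 0 v = 0 := by
  ext1 w
  simp [covDeriv, hE.fderiv_fderiv_zero hU hg hx₀ hδ, hE.fderiv_zero hδ, hE.map_zero]

include hg hx₀ hδ hU in
-- The geodesic equation holds along the whole ray, so its derivative in the parameter vanishes at
-- the centre as well; homogeneity removes the restriction to the ball.
theorem cubic_eq_zero (v : Fin n → ℝ) :
    fderiv ℝ (fderiv ℝ (fderiv ℝ E)) 0 v v v + fderiv ℝ (connection g) x₀ v v v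
      - (2 : ℝ) • connection g x₀ (connection g x₀ v v) v = 0 := by
  set P : (Fin n → ℝ) → (Fin n → ℝ) := fun v =>
    fderiv ℝ (fderiv ℝ (fderiv ℝ E)) 0 v v v + fderiv ℝ (connection g) x₀ v v v
      - (2 : ℝ) • connection g x₀ (connection g x₀ v v) v with hP
  have hball : ∀ v ∈ tangentBall g x₀ δ, P v = 0 := by
    intro v hv
    -- The geodesic equation is given only for parameters in [0, 1], so the comparison at 0 is one
    -- of one-sided derivatives.
    have h1 := (hE.hasDerivAt_covDeriv hU hg hx₀ hδ v v).hasDerivWithinAt (s := Icc 0 1)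
    have h2 : HasDerivWithinAt (fun t : ℝ => covDeriv g E (t • v) v v) 0 (Icc 0 1) 0 := by
      refine (hasDerivWithinAt_const (0 : ℝ) (Icc 0 1) (0 : Fin n → ℝ)).congr (fun t ht => ?_) ?_
      · exact hE.geodesic_eq hg hx₀ hv ht
      · exact hE.geodesic_eq hg hx₀ hv (by simp)
    have h3 := (uniqueDiffOn_Icc (zero_lt_one' ℝ) 0 (by simp)).eq_deriv _ h1 h2
    rw [hg.connection_symm hU hx₀ v (connection g x₀ v v)] at h3
    refine Eq.trans ?_ h3
    simp only [hP, two_smul]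
    abel
  obtain ⟨s, hs, hsv⟩ := exists_smul_mem_tangentBall (g := g) (x₀ := x₀) hδ v
  have h4 := hball _ hsv
  have h5 : (s * (s * s)) • P v = 0 := by
    rw [← h4]
    simp only [hP, map_smul, smul_apply, smul_sub, smul_add, mul_smul]
    rw [smul_comm (2 : ℝ) s, smul_comm (2 : ℝ) s, smul_comm (2 : ℝ) s]
  exact (smul_eq_zero.1 h5).resolve_left (mul_ne_zero hs (mul_self_ne_zero.2 hs))

include hg hx₀ hδ hU in
-- Polarization of `cubic_eq_zero`: the three D³E terms coincide by total symmetry. The slot `w` is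
-- left free because the Jacobian needs the trace over it.
theorem three_smul_fderiv_fderiv_fderiv (v w : Fin n → ℝ) :
    (3 : ℝ) • fderiv ℝ (fderiv ℝ (fderiv ℝ E)) 0 v v w
      = (2 : ℝ) • connection g x₀ (connection g x₀ v v) w
        + (4 : ℝ) • connection g x₀ v (connection g x₀ v w)
        - (2 : ℝ) • fderiv ℝ (connection g) x₀ v v w - fderiv ℝ (connection g) x₀ w v v := by
  set Γ := connection g x₀ with hΓ
  set M : (Fin n → ℝ) →L[ℝ] (Fin n → ℝ) →L[ℝ] (Fin n → ℝ) →L[ℝ] (Fin n → ℝ) :=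
    fderiv ℝ (fderiv ℝ (fderiv ℝ E)) 0 + fderiv ℝ (connection g) x₀
      + (-2 : ℝ) • (ContinuousLinearMap.compL ℝ (Fin n → ℝ) (Fin n → ℝ) _ Γ).comp Γ with hM
  have h := polarization_eq_zero M (fun v => by
    simpa [hM, sub_eq_add_neg] using hE.cubic_eq_zero hU hg hx₀ hδ v) v w
  simp only [hM, add_apply, smul_apply, ContinuousLinearMap.comp_apply,
    ContinuousLinearMap.compL_apply] at h
  rw [hE.fderiv_fderiv_fderiv_symm_left hδ w v v, hE.fderiv_fderiv_fderiv_symm_right hδ v w v,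
    hg.fderiv_connection_symm hU hx₀ v w v, hg.connection_symm hU hx₀ w v,
    hg.connection_symm hU hx₀ (connection g x₀ v w) v] at h
  funext k
  have hk := congrFun h k
  simp only [Pi.add_apply, Pi.sub_apply, Pi.smul_apply, smul_eq_mul, Pi.zero_apply] at hk ⊢
  linear_combination hk

end IsExponentialMap

end Exponential

/-! ### The Jacobian of the exponential map to second order -/

section Jacobian

variable {n : ℕ} {U : Set (Fin n → ℝ)} {g : (Fin n → ℝ) → Matrix (Fin n) (Fin n) ℝ}
  {x₀ : Fin n → ℝ} {δ : ℝ} {E : (Fin n → ℝ) → (Fin n → ℝ)}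

/-- The matrix of a continuous linear endomorphism of `ℝⁿ`. -/
def toMat (L : (Fin n → ℝ) →L[ℝ] (Fin n → ℝ)) : Matrix (Fin n) (Fin n) ℝ :=
  LinearMap.toMatrix' (L : (Fin n → ℝ) →ₗ[ℝ] (Fin n → ℝ))

theorem toMat_apply (L : (Fin n → ℝ) →L[ℝ] (Fin n → ℝ)) (i j : Fin n) :
    toMat L i j = L (Pi.single j 1) i := by
  simp [toMat, LinearMap.toMatrix'_apply]

namespace IsExponentialMap

variable (hU : IsOpen U) (hg : IsRiemannianMetric U g) (hx₀ : x₀ ∈ U) (hδ : 0 < δ)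
  (hE : IsExponentialMap U g x₀ δ E)

include hE

theorem contDiffOn_toMat_fderiv (i j : Fin n) :
    ContDiffOn ℝ ∞ (fun v => toMat (fderiv ℝ E v) i j) (tangentBall g x₀ δ) := by
  simp only [toMat_apply]
  exact contDiffOn_pi.1 (hE.contDiffOn_fderiv.clm_apply contDiffOn_const) i

include hg in
theorem contDiffOn_sqrt_det :
    ContDiffOn ℝ ∞ (fun v => √(g (E v)).det) (tangentBall g x₀ δ) := by
  refine ContDiffOn.sqrt ?_ fun v hv => (hg.det_pos (hE.mem hv)).ne'
  exact contDiffOn_det fun i j => (hg.smooth i j).comp hE.smooth hE.mapsTo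

include hg in
theorem contDiffOn_expJacobian : ContDiffOn ℝ ∞ (expJacobian g E) (tangentBall g x₀ δ) := by
  have h : expJacobian g E = fun v => (toMat (fderiv ℝ E v)).det * √(g (E v)).det := by
    funext v
    rw [expJacobian, det_eq_det_toMatrix, toMat]
  rw [h]
  exact (contDiffOn_det hE.contDiffOn_toMat_fderiv).mul (hE.contDiffOn_sqrt_det hg)

include hU hg in
-- Jacobi's formula contributes the ordinary second derivative of `E`, and the derivative of √|g|
-- contributes the trace of Γ; cyclicity of the trace merges them into the covariant derivative.
-- With the adjugate in place of the inverse, `DE` need not be invertible.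
theorem fderiv_expJacobian {v : Fin n → ℝ} (hv : v ∈ tangentBall g x₀ δ) (u : Fin n → ℝ) :
    fderiv ℝ (expJacobian g E) v u = √(g (E v)).det *
      ((toMat (fderiv ℝ E v)).adjugate * toMat (covDeriv g E v u)).trace := by
  have hc : HasDerivAt (fun t : ℝ => v + t • u) u 0 := by
    simpa using ((hasDerivAt_id (0 : ℝ)).smul_const u).const_add v
  have hv0 : v + (0 : ℝ) • u = v := by simp
  have h1 : HasDerivAt (fun t : ℝ => expJacobian g E (v + t • u))
      (fderiv ℝ (expJacobian g E) v u) 0 := by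
    have hd := ((hE.contDiffOn_expJacobian hg).contDiffAt
      (isOpen_tangentBall.mem_nhds hv)).differentiableAt (by simp)
    exact hd.hasFDerivAt.comp_hasDerivAt_of_eq (0 : ℝ) hc hv0.symm
  have h2 : HasDerivAt (fun t : ℝ => E (v + t • u)) (fderiv ℝ E v u) 0 :=
    (hE.differentiableAt hv).hasFDerivAt.comp_hasDerivAt_of_eq (0 : ℝ) hc hv0.symm
  have h3 : HasDerivAt (fun t : ℝ => fderiv ℝ E (v + t • u)) (fderiv ℝ (fderiv ℝ E) v u) 0 :=
    (hE.differentiableAt_fderiv hv).hasFDerivAt.comp_hasDerivAt_of_eq (0 : ℝ) hc hv0.symm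
  have h4 : HasDerivAt (fun t : ℝ => (toMat (fderiv ℝ E (v + t • u))).det)
      ((toMat (fderiv ℝ E (v + (0 : ℝ) • u))).adjugate
        * toMat (fderiv ℝ (fderiv ℝ E) v u)).trace 0 := by
    refine hasDerivAt_det fun i j => ?_
    simp only [toMat_apply]
    have := hasDerivAt_pi.1 (h3.clm_apply (hasDerivAt_const (0 : ℝ) (Pi.single j (1 : ℝ)))) i
    simpa using this
  have h5 := hg.hasDerivAt_sqrt_det hU h2 (by rw [hv0]; exact hE.mem hv)
  have h6 := h4.fun_mul h5
  rw [hv0] at h6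
  have h7 : (fun t : ℝ => expJacobian g E (v + t • u)) = fun t =>
      (toMat (fderiv ℝ E (v + t • u))).det * √(g (E (v + t • u))).det := by
    funext t
    rw [expJacobian, det_eq_det_toMatrix, toMat]
  rw [h7] at h1
  rw [h1.unique h6]
  set M := toMat (fderiv ℝ E v) with hM
  set N := toMat (connection g (E v) (fderiv ℝ E v u)) with hN
  have h8 : toMat (covDeriv g E v u) = toMat (fderiv ℝ (fderiv ℝ E) v u) + N * M := by
    rw [hN, hM, covDeriv, toMat, toMat, toMat, toMat, ← LinearMap.toMatrix'_comp, ← map_add]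
    rfl
  have h9 : (M.adjugate * (N * M)).trace = M.det * N.trace := by
    rw [Matrix.trace_mul_comm, Matrix.mul_assoc, Matrix.mul_adjugate, Matrix.mul_smul,
      Matrix.mul_one, Matrix.trace_smul, smul_eq_mul]
  have h10 : N.trace = ∑ i, connection g (E v) (fderiv ℝ E v u) (Pi.single i 1) i := by
    simp [Matrix.trace, hN, toMat_apply]
  rw [h8, Matrix.mul_add, Matrix.trace_add, h9, h10]
  ring

include hU hg hx₀ hδ in
theorem fderiv_expJacobian_zero : fderiv ℝ (expJacobian g E) 0 = 0 := by
  ext1 u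
  rw [hE.fderiv_expJacobian hU hg (zero_mem_tangentBall hδ), hE.covDeriv_zero hU hg hx₀ hδ]
  simp [toMat]

include hδ in
theorem expJacobian_zero : expJacobian g E 0 = √(g x₀).det := by
  rw [expJacobian, hE.fderiv_zero hδ, hE.map_zero]
  simp [ContinuousLinearMap.det]

include hU hg hx₀ hδ in
/-- The quadratic term of the Jacobian of the exponential map is given by the Ricci form. -/
theorem fderiv_fderiv_expJacobian_zero (v : Fin n → ℝ) :
    fderiv ℝ (fderiv ℝ (expJacobian g E)) 0 v v
      = -(1 / 3) * √(g x₀).det * ricciForm g x₀ v := by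
  have h0 := zero_mem_tangentBall (g := g) (x₀ := x₀) hδ
  have h0' : (0 : ℝ) • v ∈ tangentBall g x₀ δ := by simpa using h0
  have hJ : DifferentiableAt ℝ (fderiv ℝ (expJacobian g E)) ((0 : ℝ) • v) :=
    (((hE.contDiffOn_expJacobian hg).fderiv_of_isOpen isOpen_tangentBall
      (m := ∞) (by simp)).contDiffAt (isOpen_tangentBall.mem_nhds h0')).differentiableAt (by simp)
  have h1 : HasDerivAt (fun t : ℝ => fderiv ℝ (expJacobian g E) (t • v) v)
      (fderiv ℝ (fderiv ℝ (expJacobian g E)) 0 v v) 0 := by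
    have := (hasDerivAt_ray (f := fderiv ℝ (expJacobian g E)) hJ).clm_apply
      (hasDerivAt_const (0 : ℝ) v)
    simpa using this
  set c : ℝ → Fin n → Fin n → ℝ := fun t i k =>
    √(g (E (t • v))).det * (toMat (fderiv ℝ E (t • v))).adjugate i k with hc
  have h2 : (fun t : ℝ => fderiv ℝ (expJacobian g E) (t • v) v) =ᶠ[𝓝 0]
      fun t => ∑ i, ∑ k, c t i k * covDeriv g E (t • v) v (Pi.single i 1) k := by
    have hev : ∀ᶠ t in 𝓝 (0 : ℝ), t • v ∈ tangentBall g x₀ δ :=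
      (by fun_prop : Continuous fun t : ℝ => t • v).continuousAt.eventually
        (isOpen_tangentBall.mem_nhds h0')
    filter_upwards [hev] with t ht
    rw [hE.fderiv_expJacobian hU hg ht]
    simp [Matrix.trace, Matrix.mul_apply, Finset.mul_sum, hc, toMat_apply, mul_assoc]
  set D : (Fin n → ℝ) → (Fin n → ℝ) := fun w =>
    fderiv ℝ (fderiv ℝ (fderiv ℝ E)) 0 v v w + fderiv ℝ (connection g) x₀ v v w
        - connection g x₀ (connection g x₀ v v) w - connection g x₀ v (connection g x₀ v w) with hD
  have hc0 : ∀ i k, c 0 i k = √(g x₀).det * (1 : Matrix (Fin n) (Fin n) ℝ) i k := by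
    intro i k
    simp only [hc, zero_smul, hE.map_zero, hE.fderiv_zero hδ]
    have : toMat (ContinuousLinearMap.id ℝ (Fin n → ℝ)) = 1 := by
      rw [toMat, ContinuousLinearMap.coe_id, LinearMap.toMatrix'_id]
    rw [this, Matrix.adjugate_one]
  have hcd : ∀ i k, DifferentiableAt ℝ (fun t => c t i k) 0 := by
    intro i k
    have hs : DifferentiableAt ℝ (fun w => √(g (E w)).det * (toMat (fderiv ℝ E w)).adjugate i k)
        ((0 : ℝ) • v) := by
      refine (((hE.contDiffOn_sqrt_det hg).mul (contDiffOn_adjugate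
        hE.contDiffOn_toMat_fderiv i k)).contDiffAt
        (isOpen_tangentBall.mem_nhds h0')).differentiableAt (by simp)
    exact (hasDerivAt_ray hs).differentiableAt
  -- The covariant derivative vanishes at the centre, so the derivatives of the coefficients `c`
  -- drop out; only their values at 0 and their differentiability matter.
  have h3 : HasDerivAt (fun t => ∑ i, ∑ k, c t i k * covDeriv g E (t • v) v (Pi.single i 1) k)
      (∑ i, ∑ k, √(g x₀).det * (1 : Matrix (Fin n) (Fin n) ℝ) i k * D (Pi.single i 1) k) 0 := by
    refine HasDerivAt.fun_sum fun i _ => HasDerivAt.fun_sum fun k _ => ?_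
    have hd := hasDerivAt_pi.1 (hE.hasDerivAt_covDeriv hU hg hx₀ hδ v (Pi.single i 1)) k
    have hm := (hcd i k).hasDerivAt.fun_mul hd
    refine hm.congr_deriv ?_
    simp only [zero_smul, hc0]
    rw [hE.covDeriv_zero hU hg hx₀ hδ, _root_.zero_apply, Pi.zero_apply, mul_zero, zero_add]
  rw [h1.unique (h3.congr_of_eventuallyEq h2), hg.ricciForm_eq hU hx₀]
  simp only [Matrix.one_apply, mul_ite, mul_one, mul_zero, ite_mul, zero_mul, Finset.sum_ite_eq,
    Finset.mem_univ, if_true]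
  rw [Finset.mul_sum]
  refine Finset.sum_congr rfl fun i _ => ?_
  -- After elimination of D³E, the map `D` is -1/3 times the curvature operator w ↦ R(w,v)v, so the
  -- diagonal entries agree one by one.
  have h4 := congrFun (hE.three_smul_fderiv_fderiv_fderiv hU hg hx₀ hδ v (Pi.single i 1)) i
  simp only [hD, Pi.add_apply, Pi.sub_apply, Pi.smul_apply, smul_eq_mul] at h4 ⊢
  rw [hg.fderiv_connection_symm hU hx₀ v v] at h4 ⊢
  rw [hg.connection_symm hU hx₀ (Pi.single i 1) v, hg.connection_symm hU hx₀ (Pi.single i 1)]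
  linear_combination (1 / 3 * √(g x₀).det) * h4

include hU hg hx₀ hδ in
/-- Second order expansion of the Jacobian of the exponential map. -/
theorem exists_expJacobian_bound : ∃ C r : ℝ, 0 < r ∧ ∀ v : Fin n → ℝ, ‖v‖ < r →
    |expJacobian g E v / √(g x₀).det - (1 - 1 / 6 * ricciForm g x₀ v)| ≤ C * ‖v‖ ^ 3 := by
  have h0 := zero_mem_tangentBall (g := g) (x₀ := x₀) hδ
  obtain ⟨C, r, hr, h⟩ := taylor_two_bound (f := expJacobian g E)
    (((hE.contDiffOn_expJacobian hg).contDiffAt (isOpen_tangentBall.mem_nhds h0)).of_le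
      (by norm_cast))
  have hs : 0 < √(g x₀).det := Real.sqrt_pos.2 (hg.det_pos hx₀)
  refine ⟨C / √(g x₀).det, r, hr, fun v hv => ?_⟩
  have h1 := h v hv
  rw [hE.fderiv_expJacobian_zero hU hg hx₀ hδ, hE.fderiv_fderiv_expJacobian_zero hU hg hx₀ hδ,
    hE.expJacobian_zero hδ] at h1
  have h2 : expJacobian g E v / √(g x₀).det - (1 - 1 / 6 * ricciForm g x₀ v)
      = (expJacobian g E v - √(g x₀).det - (0 : (Fin n → ℝ) →L[ℝ] ℝ) v
        - 1 / 2 * (-(1 / 3) * √(g x₀).det * ricciForm g x₀ v)) / √(g x₀).det := by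
    rw [_root_.zero_apply]
    field_simp
    ring
  rw [h2, abs_div, abs_of_pos hs, div_mul_eq_mul_div C]
  exact div_le_div_of_nonneg_right h1 hs.le

end IsExponentialMap

end Jacobian

/-! ### Comparison of norms and antisymmetries of the curvature -/

/-- A positive quadratic form has a positive minimum on the compact unit sphere of the sup norm.
This bound makes the remainder uniform in `q` and in the parametrization. `NeZero` ensures that the
sphere is nonempty. -/
theorem IsRiemannianMetric.exists_norm_le {n : ℕ} [NeZero n] {U : Set (Fin n → ℝ)}
    {g : (Fin n → ℝ) → Matrix (Fin n) (Fin n) ℝ} (hg : IsRiemannianMetric U g) {x : Fin n → ℝ}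
    (hx : x ∈ U) : ∃ K : ℝ, 0 < K ∧ ∀ v, metricForm g x v v = 1 → ‖v‖ ≤ K := by
  have hne : (Metric.sphere (0 : Fin n → ℝ) 1).Nonempty :=
    NormedSpace.sphere_nonempty.2 zero_le_one
  obtain ⟨w, hw, hmin⟩ := (isCompact_sphere (0 : Fin n → ℝ) 1).exists_isMinOn hne
    (f := fun v => metricForm g x v v) (by fun_prop)
  have hw0 : w ≠ 0 := by
    rintro rfl
    simp at hw
  have hc := hg.metricForm_pos hx hw0
  set c := metricForm g x w w with hcdef
  refine ⟨√(1 / c), Real.sqrt_pos.2 (by positivity), fun v hv => ?_⟩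
  have hv0 : v ≠ 0 := by
    rintro rfl
    simp at hv
  have hnv : 0 < ‖v‖ := norm_pos_iff.2 hv0
  have h1 : c ≤ metricForm g x (‖v‖⁻¹ • v) (‖v‖⁻¹ • v) := hmin (by
    simp [norm_smul, hnv.ne'])
  simp only [map_smul, smul_apply, smul_eq_mul, hv, mul_one] at h1
  refine Real.le_sqrt_of_sq_le ?_
  rw [le_div_iff₀ hc]
  calc ‖v‖ ^ 2 * c ≤ ‖v‖ ^ 2 * (‖v‖⁻¹ * ‖v‖⁻¹) := by gcongr
    _ = 1 := by field_simp

/-- Purely formal, for any matrix field; antisymmetry in the last pair also needs the symmetry of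
`g`. -/
theorem curvature_antisymm_left {n : ℕ} (g : (Fin n → ℝ) → Matrix (Fin n) (Fin n) ℝ)
    (x : Fin n → ℝ) (i j k l : Fin n) : curvature g x j i k l = -curvature g x i j k l := by
  simp only [curvature, mul_sub, Finset.sum_sub_distrib]
  ring

theorem IsRiemannianMetric.curvature_antisymm_right {n : ℕ} {U : Set (Fin n → ℝ)}
    {g : (Fin n → ℝ) → Matrix (Fin n) (Fin n) ℝ} (hg : IsRiemannianMetric U g) {x : Fin n → ℝ}
    (hx : x ∈ U) (i j k l : Fin n) : curvature g x i j l k = -curvature g x i j k l := by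
  have h : ∀ i j k l, ∑ a, ∑ b, g x a b * (christoffel g x a i k * christoffel g x b j l)
      = ∑ a, ∑ b, g x a b * (christoffel g x a j l * christoffel g x b i k) := by
    intro i j k l
    rw [Finset.sum_comm]
    refine Finset.sum_congr rfl fun a _ => Finset.sum_congr rfl fun b _ => ?_
    rw [hg.symm hx]
    ring
  simp only [curvature, mul_sub, Finset.sum_sub_distrib]
  rw [h i j k l, h i j l k]
  ring

/-! ### The frame formed by a unit vector and a basis of its orthogonal complement -/

section Frame

variable {m : ℕ} {G : Matrix (Fin (m + 1)) (Fin (m + 1)) ℝ} {e : Fin (m + 1) → ℝ}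
  {ξ : Fin m → Fin (m + 1) → ℝ}

/-- The matrix with the columns `e, ξ₁, …, ξₘ`. -/
def frame (e : Fin (m + 1) → ℝ) (ξ : Fin m → Fin (m + 1) → ℝ) :
    Matrix (Fin (m + 1)) (Fin (m + 1)) ℝ :=
  Matrix.of fun i a => (Fin.cons e ξ : Fin (m + 1) → Fin (m + 1) → ℝ) a i

theorem pairing_comm (hG : G.PosDef) (v w : Fin (m + 1) → ℝ) : pairing G v w = pairing G w v := by
  rw [pairing, pairing, Finset.sum_comm]
  refine Finset.sum_congr rfl fun i _ => Finset.sum_congr rfl fun j _ => ?_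
  have := hG.isHermitian.apply i j
  rw [star_trivial] at this
  rw [this]
  ring

/-- The span of the `ξ` lies in the kernel of the functional `pairing G e`, which takes the value 1
on `e`. -/
theorem isUnit_frame (he : pairing G e e = 1) (hξ : ∀ α, pairing G e (ξ α) = 0)
    (hli : LinearIndependent ℝ ξ) : IsUnit (frame e ξ) := by
  have h : LinearIndependent ℝ (Fin.cons e ξ : Fin (m + 1) → Fin (m + 1) → ℝ) := by
    refine linearIndependent_finCons.2 ⟨hli, fun hmem => ?_⟩
    have h1 : Submodule.span ℝ (range ξ)
        ≤ LinearMap.ker (metricForm (fun _ => G) 0 e : (Fin (m + 1) → ℝ) →ₗ[ℝ] ℝ) := by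
      rw [Submodule.span_le]
      rintro _ ⟨α, rfl⟩
      simpa [metricForm_apply] using hξ α
    have h2 := h1 hmem
    simp [metricForm_apply, he] at h2
  exact Matrix.linearIndependent_cols_iff_isUnit.1 h

theorem gram_frame (a b : Fin (m + 1)) : ((frame e ξ)ᵀ * G * frame e ξ) a b
    = pairing G ((Fin.cons e ξ : Fin (m + 1) → Fin (m + 1) → ℝ) a)
      ((Fin.cons e ξ : Fin (m + 1) → Fin (m + 1) → ℝ) b) := by
  simp only [Matrix.mul_apply, frame, Matrix.transpose_apply, Matrix.of_apply, pairing,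
    Finset.sum_mul]
  rw [Finset.sum_comm]
  refine Finset.sum_congr rfl fun i _ => Finset.sum_congr rfl fun j _ => ?_
  ring

/-- The Gram matrix of the frame is block diagonal with blocks 1 and κ, by orthogonality. It
expresses the frame determinant of the coordinate change through √|κ|. -/
theorem det_frame (he : pairing G e e = 1) (hξ : ∀ α, pairing G e (ξ α) = 0) :
    (frame e ξ).det ^ 2 * G.det = (Matrix.of fun α β => pairing G (ξ α) (ξ β)).det := by
  have h1 : ((frame e ξ)ᵀ * G * frame e ξ).det = (frame e ξ).det ^ 2 * G.det := by
    rw [Matrix.det_mul, Matrix.det_mul, Matrix.det_transpose]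
    ring
  rw [← h1, Matrix.det_succ_row_zero, Fin.sum_univ_succ]
  have h2 : ∀ α : Fin m, ((frame e ξ)ᵀ * G * frame e ξ) 0 α.succ = 0 := by
    intro α
    rw [gram_frame]
    simpa using hξ α
  have h3 : ((frame e ξ)ᵀ * G * frame e ξ) 0 0 = 1 := by
    rw [gram_frame]
    simpa using he
  simp only [h2, h3]
  simp only [Fin.val_zero, pow_zero, mul_one, one_mul, mul_zero, zero_mul, Finset.sum_const_zero,
    add_zero]
  congr 1
  ext α β
  simp only [Matrix.submatrix_apply, Fin.zero_succAbove, gram_frame, Fin.cons_succ,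
    Matrix.of_apply]

/-- The completeness relation of the frame: the right-hand side composed with `G` fixes `e` and
every `ξ α`, and these form a basis. -/
theorem inv_eq_frame (hG : G.PosDef) (he : pairing G e e = 1) (hξ : ∀ α, pairing G e (ξ α) = 0)
    (hli : LinearIndependent ℝ ξ) (j l : Fin (m + 1)) : G⁻¹ j l = e j * e l
      + ∑ α, ∑ β, (Matrix.of fun α β => pairing G (ξ α) (ξ β))⁻¹ α β * ξ α j * ξ β l := by
  set K := Matrix.of fun α β => pairing G (ξ α) (ξ β) with hK
  have hB := isUnit_frame he hξ hli
  have hdetK : K.det ≠ 0 := by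
    rw [hK, ← det_frame he hξ]
    have h1 := (Matrix.isUnit_iff_isUnit_det _).1 hB
    exact mul_ne_zero (pow_ne_zero 2 h1.ne_zero) hG.det_pos.ne'
  set N : Matrix (Fin (m + 1)) (Fin (m + 1)) ℝ := Matrix.of fun j l => e j * e l
      + ∑ α, ∑ β, K⁻¹ α β * ξ α j * ξ β l with hN
  have h2 : ∀ j a, (N * G * frame e ξ) j a
      = e j * pairing G e ((Fin.cons e ξ : Fin (m + 1) → Fin (m + 1) → ℝ) a)
        + ∑ α, ξ α j * ∑ β, K⁻¹ α β *
          pairing G (ξ β) ((Fin.cons e ξ : Fin (m + 1) → Fin (m + 1) → ℝ) a) := by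
    intro j a
    generalize hb : (Fin.cons e ξ : Fin (m + 1) → Fin (m + 1) → ℝ) a = b
    have h3 : (N * G * frame e ξ) j a = ∑ l, ∑ k, N j l * G l k * b k := by
      simp only [Matrix.mul_apply, frame, Matrix.of_apply, Finset.sum_mul, hb]
      rw [Finset.sum_comm]
    rw [h3]
    simp only [hN, Matrix.of_apply, add_mul, Finset.sum_add_distrib, pairing, Finset.mul_sum,
      Finset.sum_mul]
    congr 1
    · refine Finset.sum_congr rfl fun i _ => Finset.sum_congr rfl fun k _ => ?_
      ring
    · rw [Finset.sum_congr rfl fun l _ => Finset.sum_comm, Finset.sum_comm]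
      refine Finset.sum_congr rfl fun α _ => ?_
      rw [Finset.sum_congr rfl fun l _ => Finset.sum_comm, Finset.sum_comm]
      refine Finset.sum_congr rfl fun β _ => Finset.sum_congr rfl fun l _ =>
        Finset.sum_congr rfl fun k _ => ?_
      ring
  have h4 : N * G * frame e ξ = 1 * frame e ξ := by
    ext j a
    rw [h2, Matrix.one_mul]
    refine Fin.cases ?_ (fun γ => ?_) a
    · simp [he, pairing_comm hG (ξ _) e, hξ, frame]
    · have h5 : ∀ α, ∑ β, K⁻¹ α β * pairing G (ξ β) (ξ γ) = (1 : Matrix (Fin m) (Fin m) ℝ) α γ := by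
        intro α
        rw [← Matrix.nonsing_inv_mul K hdetK.isUnit, Matrix.mul_apply]
        rfl
      simp [h5, hξ, frame, Matrix.one_apply]
  have h6 : N * G = 1 := hB.mul_right_cancel h4
  rw [Matrix.inv_eq_left_inv h6]
  rfl

end Frame

/-! ### Geodesic spherical coordinates -/

section Spherical

variable {m : ℕ} {U : Set (Fin (m + 1) → ℝ)}
  {g : (Fin (m + 1) → ℝ) → Matrix (Fin (m + 1)) (Fin (m + 1)) ℝ}
  {x₀ : Fin (m + 1) → ℝ} {δ : ℝ} {E : (Fin (m + 1) → ℝ) → (Fin (m + 1) → ℝ)}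
  {Q : Set (Fin m → ℝ)} {e : (Fin m → ℝ) → (Fin (m + 1) → ℝ)} {q : Fin m → ℝ}

theorem IsSphericalParam.pairing_xi (hg : IsRiemannianMetric U g) (hx₀ : x₀ ∈ U)
    (he : IsSphericalParam (g x₀) Q e) (hq : q ∈ Q) (α : Fin m) :
    pairing (g x₀) (e q) (xi e q α) = 0 := by
  have hd := ((he.differentiable q hq).differentiableAt (he.isOpen.mem_nhds hq)).hasFDerivAt
  have h1 := ((metricForm g x₀).hasFDerivAt.comp q hd).clm_apply hd
  have h2 : (fun y => metricForm g x₀ (e y) (e y)) =ᶠ[𝓝 q] fun _ => 1 := by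
    filter_upwards [he.isOpen.mem_nhds hq] with y hy
    rw [metricForm_apply, he.unit y hy]
  have h3 := (h1.congr_of_eventuallyEq h2.symm).unique (hasFDerivAt_const (1 : ℝ) q)
  have h4 := congrArg (fun L => L (Pi.single α 1)) h3
  simp only [add_apply, ContinuousLinearMap.comp_apply, ContinuousLinearMap.flip_apply,
    Function.comp_apply, zero_apply] at h4
  rw [hg.metricForm_symm hx₀ _ (e q)] at h4
  rw [← metricForm_apply, xi]
  linarith

/-- The spherical function is four times the Ricci form. -/
theorem sphericalFunction_eq (hg : IsRiemannianMetric U g) (hx₀ : x₀ ∈ U)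
    (he : IsSphericalParam (g x₀) Q e) (hq : q ∈ Q) :
    sphericalFunction g x₀ e q = 4 * ricciForm g x₀ (e q) := by
  set T : Fin (m + 1) → Fin (m + 1) → ℝ := fun j l =>
    ∑ α, ∑ β, (kappa (g x₀) e q)⁻¹ α β * xi e q α j * xi e q β l with hT
  have hinv : ∀ j l, (g x₀)⁻¹ j l = e q j * e q l + T j l := fun j l =>
    inv_eq_frame (hg.posDef x₀ hx₀) (he.unit q hq) (he.pairing_xi hg hx₀ hq) (he.regular q hq) j l
  set R := curvature g x₀ with hR
  -- The product of two antisymmetrized tensors gives four contractions; antisymmetry of R in each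
  -- index pair makes each equal to `A` after its sign, whence the factor 4.
  have h1 : sphericalFunction g x₀ e q = ∑ i, ∑ j, ∑ k, ∑ l,
      (R i j k l * (e q i * e q k * T j l) - R i j k l * (e q i * e q l * T j k)
        - R i j k l * (e q j * e q k * T i l) + R i j k l * (e q j * e q l * T i k)) := by
    unfold sphericalFunction
    refine Finset.sum_congr rfl fun i _ => Finset.sum_congr rfl fun j _ =>
      Finset.sum_congr rfl fun k _ => Finset.sum_congr rfl fun l _ => ?_
    simp only [hT, Finset.mul_sum, ← Finset.sum_sub_distrib, ← Finset.sum_add_distrib]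
    refine Finset.sum_congr rfl fun α _ => Finset.sum_congr rfl fun β _ => ?_
    simp only [sTensor, ← hR]
    ring
  have hL : ∀ i j k l, R j i k l = -R i j k l := curvature_antisymm_left g x₀
  have hRt : ∀ i j k l, R i j l k = -R i j k l := hg.curvature_antisymm_right hx₀
  set A := ∑ i, ∑ j, ∑ k, ∑ l, R i j k l * (e q i * e q k * T j l) with hA
  have h2 : ∑ i, ∑ j, ∑ k, ∑ l, R i j k l * (e q i * e q l * T j k) = -A := by
    rw [hA]
    simp only [← Finset.sum_neg_distrib]
    refine Finset.sum_congr rfl fun i _ => Finset.sum_congr rfl fun j _ => ?_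
    rw [Finset.sum_comm]
    refine Finset.sum_congr rfl fun k _ => Finset.sum_congr rfl fun l _ => ?_
    rw [hRt]
    ring
  have h3 : ∑ i, ∑ j, ∑ k, ∑ l, R i j k l * (e q j * e q k * T i l) = -A := by
    rw [hA, Finset.sum_comm]
    simp only [← Finset.sum_neg_distrib]
    refine Finset.sum_congr rfl fun i _ => Finset.sum_congr rfl fun j _ =>
      Finset.sum_congr rfl fun k _ => Finset.sum_congr rfl fun l _ => ?_
    rw [hL]
    ring
  have h4 : ∑ i, ∑ j, ∑ k, ∑ l, R i j k l * (e q j * e q l * T i k) = A := by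
    rw [hA, Finset.sum_comm]
    refine Finset.sum_congr rfl fun i _ => Finset.sum_congr rfl fun j _ => ?_
    rw [Finset.sum_comm]
    refine Finset.sum_congr rfl fun k _ => Finset.sum_congr rfl fun l _ => ?_
    rw [hL, hRt]
    ring
  -- R vanishes when `e` fills both slots of a pair, so the tangential projection `T` may be
  -- replaced by the full inverse metric.
  have h5 : ∑ i, ∑ j, ∑ k, ∑ l, R i j k l * (e q i * e q j * e q k * e q l) = 0 := by
    have : ∑ i, ∑ j, ∑ k, ∑ l, R i j k l * (e q i * e q j * e q k * e q l)
        = -∑ i, ∑ j, ∑ k, ∑ l, R i j k l * (e q i * e q j * e q k * e q l) := by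
      conv_lhs => rw [Finset.sum_comm]
      simp only [← Finset.sum_neg_distrib]
      refine Finset.sum_congr rfl fun i _ => Finset.sum_congr rfl fun j _ =>
        Finset.sum_congr rfl fun k _ => Finset.sum_congr rfl fun l _ => ?_
      rw [hL]
      ring
    linarith
  have h6 : ricciForm g x₀ (e q) = A := by
    rw [hA, ← add_zero (∑ i, _), ← h5]
    simp only [ricciForm, ← Finset.sum_add_distrib, hinv]
    refine Finset.sum_congr rfl fun i _ => Finset.sum_congr rfl fun j _ =>
      Finset.sum_congr rfl fun k _ => Finset.sum_congr rfl fun l _ => ?_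
    rw [← hR]
    ring
  rw [h1, h6]
  simp only [Finset.sum_add_distrib, Finset.sum_sub_distrib]
  rw [h2, h3, h4]
  ring

/-- The Jacobian determinant of the geodesic spherical coordinates. -/
theorem det_fderiv_sphericalMap (hE : IsExponentialMap U g x₀ δ E)
    (he : IsSphericalParam (g x₀) Q e) (hq : q ∈ Q) {ℓ : ℝ}
    (hℓ : ℓ • e q ∈ tangentBall g x₀ δ) :
    (fderiv ℝ (sphericalMap E e) (Fin.cons ℓ q)).det
      = (fderiv ℝ E (ℓ • e q)).det * ((frame (e q) (xi e q)).det * ℓ ^ m) := by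
  set p : Fin (m + 1) → ℝ := Fin.cons ℓ q with hp
  have hp0 : p 0 = ℓ := by simp [hp]
  have hpt : Fin.tail p = q := by simp [hp]
  set tail : (Fin (m + 1) → ℝ) →L[ℝ] (Fin m → ℝ) :=
    ContinuousLinearMap.pi fun α => ContinuousLinearMap.proj α.succ with htail
  have hd : HasFDerivAt e (fderiv ℝ e q) (tail p) := by
    have : tail p = q := hpt
    rw [this]
    exact ((he.differentiable q hq).differentiableAt (he.isOpen.mem_nhds hq)).hasFDerivAt
  have h1 : HasFDerivAt (fun p : Fin (m + 1) → ℝ => p 0 • e (tail p))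
      (p 0 • ((fderiv ℝ e q).comp tail)
        + (ContinuousLinearMap.proj (R := ℝ) (φ := fun _ : Fin (m + 1) => ℝ) 0).smulRight
          (e (tail p))) p :=
    (ContinuousLinearMap.proj (R := ℝ) (φ := fun _ : Fin (m + 1) => ℝ) 0).hasFDerivAt.fun_smul
      (hd.comp p tail.hasFDerivAt)
  have hetail : e (tail p) = e q := congrArg e hpt
  rw [hp0, hetail] at h1
  set L := ℓ • ((fderiv ℝ e q).comp tail)
        + (ContinuousLinearMap.proj (R := ℝ) (φ := fun _ : Fin (m + 1) => ℝ) 0).smulRight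
          (e q) with hL
  have h2 : HasFDerivAt E (fderiv ℝ E (ℓ • e q)) (p 0 • e (tail p)) := by
    rw [hp0, hetail]
    exact (hE.differentiableAt hℓ).hasFDerivAt
  have h3 : HasFDerivAt (sphericalMap E e) ((fderiv ℝ E (ℓ • e q)).comp L) p := h2.comp p h1
  rw [h3.fderiv]
  have h4 : L.det = (frame (e q) (xi e q)).det * ℓ ^ m := by
    -- Before `E` is applied, ∂/∂ℓ yields the column `e` and each ∂/∂q^α yields ℓ ξ_α, hence the
    -- factor ℓ^m = ℓ^{n-1}.
    have h5 : toMat L = frame (e q) (xi e q) * Matrix.diagonal (Fin.cons 1 fun _ => ℓ) := by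
      ext i a
      rw [toMat_apply, Matrix.mul_diagonal]
      refine Fin.cases ?_ (fun γ => ?_) a
      · have : tail (Pi.single 0 1) = 0 := by
          ext α
          simp [htail]
        simp [hL, this, frame]
      · have : tail (Pi.single γ.succ 1) = Pi.single γ 1 := by
          ext α
          simp [htail, Pi.single_apply]
        simp [hL, this, frame, xi, mul_comm]
    rw [det_eq_det_toMatrix, ← toMat, h5, Matrix.det_mul, Matrix.det_diagonal, Fin.prod_univ_succ]
    simp
  rw [← h4, ContinuousLinearMap.det, ContinuousLinearMap.det, ContinuousLinearMap.det,
    ← LinearMap.det_comp]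
  rfl

/-- The density in geodesic spherical coordinates in terms of the gaussian one. -/
theorem sphericalDensity_eq (hg : IsRiemannianMetric U g) (hx₀ : x₀ ∈ U)
    (hE : IsExponentialMap U g x₀ δ E) (he : IsSphericalParam (g x₀) Q e) (hq : q ∈ Q)
    {ρ : (Fin (m + 1) → ℝ) → ℝ} {Z : ℝ}
    (hρ : ∀ v ∈ tangentBall g x₀ δ, ρ (E v) = 1 / Z * Real.exp (-(1 / 2) * pairing (g x₀) v v)
      * volumeDensity g (E v)) {ℓ : ℝ} (hℓ0 : 0 < ℓ) (hℓ : ℓ < δ) :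
    sphericalDensity ρ E e ℓ q = 1 / Z * (|expJacobian g E (ℓ • e q)| / √(g x₀).det)
      * gaussianDensity (g x₀) e ℓ q := by
  have hnorm : pairing (g x₀) (ℓ • e q) (ℓ • e q) = ℓ ^ 2 := by
    have := he.unit q hq
    rw [← metricForm_apply] at this ⊢
    simp only [map_smul, smul_apply, smul_eq_mul, this]
    ring
  have hmem : ℓ • e q ∈ tangentBall g x₀ δ := by
    rw [tangentBall, mem_ofPred_eq, hnorm]
    gcongr
  have hx := hE.mem hmem
  have hmap : sphericalMap E e (Fin.cons ℓ q) = E (ℓ • e q) := by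
    simp [sphericalMap]
  have hκ : (kappa (g x₀) e q).det = (frame (e q) (xi e q)).det ^ 2 * (g x₀).det :=
    (det_frame (he.unit q hq) (he.pairing_xi hg hx₀ hq)).symm
  have hs : 0 < √(g x₀).det := Real.sqrt_pos.2 (hg.det_pos hx₀)
  -- The volume density carries `m + 1` factors (2π)^{-1/2} and κ only `m`; the one left over is the
  -- separate 1/√(2π) of the gaussian density.
  have hvol : √((2 * π)⁻¹ ^ (m + 1) * (g (E (ℓ • e q))).det)
      = √((2 * π)⁻¹ ^ m) * (√(2 * π))⁻¹ * √(g (E (ℓ • e q))).det := by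
    rw [Real.sqrt_mul (by positivity), pow_succ, Real.sqrt_mul (by positivity), Real.sqrt_inv]
  have hgauss : √((2 * π)⁻¹ ^ m * ((frame (e q) (xi e q)).det ^ 2 * (g x₀).det))
      = √((2 * π)⁻¹ ^ m) * (|(frame (e q) (xi e q)).det| * √(g x₀).det) := by
    rw [Real.sqrt_mul (by positivity), Real.sqrt_mul (sq_nonneg _), Real.sqrt_sq_eq_abs]
  rw [sphericalDensity, hmap, hρ _ hmem, hnorm, det_fderiv_sphericalMap hE he hq hmem,
    gaussianDensity, volumeDensity, Matrix.det_smul, Matrix.det_smul, hκ, Fintype.card_fin,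
    Fintype.card_fin, expJacobian, abs_mul, abs_mul, abs_mul, abs_of_pos (pow_pos hℓ0 m),
    abs_of_nonneg (Real.sqrt_nonneg _), hvol, hgauss]
  field_simp

theorem ricciForm_smul {n : ℕ} (g : (Fin n → ℝ) → Matrix (Fin n) (Fin n) ℝ) (x v : Fin n → ℝ)
    (s : ℝ) : ricciForm g x (s • v) = s ^ 2 * ricciForm g x v := by
  simp only [ricciForm, Finset.mul_sum]
  refine Finset.sum_congr rfl fun i _ => Finset.sum_congr rfl fun j _ =>
      Finset.sum_congr rfl fun k _ => Finset.sum_congr rfl fun l _ => ?_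
  simp only [Pi.smul_apply, smul_eq_mul]
  ring

/-- The expansion of the Jacobian in geodesic spherical coordinates. -/
theorem exists_spherical_bound (hU : IsOpen U) (hg : IsRiemannianMetric U g) (hx₀ : x₀ ∈ U)
    (hδ : 0 < δ) (hE : IsExponentialMap U g x₀ δ E) :
    ∃ C ε : ℝ, 0 < ε ∧ ε ≤ δ ∧ ∀ (Q : Set (Fin m → ℝ)) (e : (Fin m → ℝ) → (Fin (m + 1) → ℝ)),
      IsSphericalParam (g x₀) Q e → ∀ q ∈ Q, ∀ ℓ ∈ Ioo 0 ε,
        |(|expJacobian g E (ℓ • e q)| / √(g x₀).det)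
          - (1 - 1 / 24 * ℓ ^ 2 * sphericalFunction g x₀ e q)| ≤ C * ℓ ^ 3 := by
  have h0 := zero_mem_tangentBall (g := g) (x₀ := x₀) hδ
  have hs : 0 < √(g x₀).det := Real.sqrt_pos.2 (hg.det_pos hx₀)
  obtain ⟨C, r, hr, hC⟩ := hE.exists_expJacobian_bound hU hg hx₀ hδ
  obtain ⟨K, hK, hnorm⟩ := hg.exists_norm_le hx₀
  -- Positivity of the Jacobian near the centre removes the absolute value that comes from the
  -- change of variables.
  have hpos : ∀ᶠ v in 𝓝 (0 : Fin (m + 1) → ℝ), 0 < expJacobian g E v := by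
    have hc := ((hE.contDiffOn_expJacobian hg).contDiffAt
      (isOpen_tangentBall.mem_nhds h0)).continuousAt
    refine hc.eventually (lt_mem_nhds ?_)
    rw [hE.expJacobian_zero hδ]
    exact hs
  obtain ⟨r', hr', hpos'⟩ := Metric.eventually_nhds_iff.1 hpos
  -- Since `‖ℓ • e q‖ ≤ ℓ * K`, the bounds `r / K` and `r' / K` keep the vector in both
  -- neighbourhoods, and the cubic remainder acquires `K ^ 3`.
  refine ⟨|C| * K ^ 3, min δ (min (r / K) (r' / K)), by positivity, min_le_left _ _, ?_⟩
  rintro Q e he q hq ℓ ⟨hℓ0, hℓ⟩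
  have hle : ‖ℓ • e q‖ ≤ ℓ * K := by
    rw [norm_smul, Real.norm_of_nonneg hℓ0.le]
    gcongr
    exact hnorm _ (by rw [metricForm_apply]; exact he.unit q hq)
  have hℓr : ℓ < r / K := hℓ.trans_le ((min_le_right _ _).trans (min_le_left _ _))
  have hℓr' : ℓ < r' / K := hℓ.trans_le ((min_le_right _ _).trans (min_le_right _ _))
  rw [lt_div_iff₀ hK] at hℓr hℓr'
  rw [abs_of_pos (hpos' (by rw [dist_zero_right]; exact hle.trans_lt hℓr'))]
  have h1 := hC _ (hle.trans_lt hℓr)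
  rw [ricciForm_smul] at h1
  rw [sphericalFunction_eq hg hx₀ he hq]
  have h2 : 1 - 1 / 24 * ℓ ^ 2 * (4 * ricciForm g x₀ (e q))
      = 1 - 1 / 6 * (ℓ ^ 2 * ricciForm g x₀ (e q)) := by ring
  rw [h2]
  calc _ ≤ C * ‖ℓ • e q‖ ^ 3 := h1
    _ ≤ |C| * (ℓ * K) ^ 3 := by
      gcongr
      exact le_abs_self C
    _ = _ := by ring

/-- A distribution of Riemannian gaussian form has the gaussian expansion to third order. -/
theorem hasAsymptoticDistribution_of_gaussian (hU : IsOpen U) (hg : IsRiemannianMetric U g)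
    (hx₀ : x₀ ∈ U) (hδ : 0 < δ) (hE : IsExponentialMap U g x₀ δ E)
    {ρ : (Fin (m + 1) → ℝ) → ℝ} {Z : ℝ}
    (hρ : ∀ v ∈ tangentBall g x₀ δ, ρ (E v) = 1 / Z * Real.exp (-(1 / 2) * pairing (g x₀) v v)
      * volumeDensity g (E v)) : HasAsymptoticDistribution g ρ x₀ E Z 3 := by
  obtain ⟨C, ε, hε, hεδ, h⟩ := exists_spherical_bound hU hg hx₀ hδ hE
  refine ⟨C, ε, hε, fun Q e he q hq ℓ hℓ => ⟨_, h Q e he q hq ℓ hℓ, ?_⟩⟩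
  rw [sphericalDensity_eq hg hx₀ hE he hq hρ hℓ.1 (hℓ.2.trans_le hεδ)]
  ring

/-- If the Jacobian of the exponential map is constant, then the gaussian expansion is exact. -/
theorem hasAsymptoticDistribution_of_expJacobian_eq (hU : IsOpen U) (hg : IsRiemannianMetric U g)
    (hx₀ : x₀ ∈ U) (hδ : 0 < δ) (hE : IsExponentialMap U g x₀ δ E)
    {ρ : (Fin (m + 1) → ℝ) → ℝ} {Z : ℝ}
    (hρ : ∀ v ∈ tangentBall g x₀ δ, ρ (E v) = 1 / Z * Real.exp (-(1 / 2) * pairing (g x₀) v v)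
      * volumeDensity g (E v))
    (hJ : ∀ v ∈ tangentBall g x₀ δ, expJacobian g E v = √(g x₀).det) (d : ℕ) :
    HasAsymptoticDistribution g ρ x₀ E Z d := by
  obtain ⟨C, ε, hε, hεδ, h⟩ := exists_spherical_bound hU hg hx₀ hδ hE
  have hs : 0 < √(g x₀).det := Real.sqrt_pos.2 (hg.det_pos hx₀)
  refine ⟨0, ε, hε, fun Q e he q hq ℓ hℓ => ⟨0, by simp, ?_⟩⟩
  have hone : ∀ t ∈ Ioo 0 ε, |expJacobian g E (t • e q)| / √(g x₀).det = 1 := by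
    intro t ht
    have hmem : t • e q ∈ tangentBall g x₀ δ := by
      have h1 := he.unit q hq
      have h2 := ht.2.trans_le hεδ
      rw [tangentBall, mem_ofPred_eq, ← metricForm_apply]
      rw [← metricForm_apply] at h1
      simp only [map_smul, smul_apply, smul_eq_mul, h1]
      nlinarith [ht.1]
    rw [hJ _ hmem, abs_of_pos hs, div_self hs.ne']
  have hF : sphericalFunction g x₀ e q = 0 := by
    by_contra hne
    -- With a constant Jacobian the general bound reads t²|ℱ|/24 ≤ C t³; dividing by t² and letting
    -- t → 0 gives ℱ = 0.
    have hb : ∀ t ∈ Ioo 0 ε, |sphericalFunction g x₀ e q| ≤ 24 * C * t := by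
      intro t ht
      have h1 := h Q e he q hq t ht
      rw [hone t ht] at h1
      have h2 : (1 : ℝ) - (1 - 1 / 24 * t ^ 2 * sphericalFunction g x₀ e q)
          = 1 / 24 * t ^ 2 * sphericalFunction g x₀ e q := by ring
      have ht2 : 0 < 1 / 24 * t ^ 2 := by have := ht.1; positivity
      rw [h2, abs_mul, abs_of_pos ht2] at h1
      refine le_of_mul_le_mul_left (h1.trans_eq ?_) ht2
      ring
    have hlim : Tendsto (fun t : ℝ => 24 * C * t) (𝓝[>] 0) (𝓝 0) := by
      have : Continuous fun t : ℝ => 24 * C * t := by fun_prop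
      simpa using (this.tendsto 0).mono_left nhdsWithin_le_nhds
    have hle := ge_of_tendsto hlim (Filter.eventually_of_mem (Ioo_mem_nhdsGT hε) hb)
    exact hne (abs_nonpos_iff.1 hle)
  rw [sphericalDensity_eq hg hx₀ hE he hq hρ hℓ.1 (hℓ.2.trans_le hεδ), hone ℓ hℓ, hF]
  ring

end Spherical

/-! ### Fluctuation metrics and the Riemannian gaussian representation -/

section Fluctuation

variable {n : ℕ} {U : Set (Fin n → ℝ)} {g : (Fin n → ℝ) → Matrix (Fin n) (Fin n) ℝ}
  {ρ : (Fin n → ℝ) → ℝ} {x₀ : Fin n → ℝ} {δ : ℝ} {E : (Fin n → ℝ) → (Fin n → ℝ)}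

theorem IsRiemannianMetric.det_smul_inv_pos (hg : IsRiemannianMetric U g) {x : Fin n → ℝ}
    (hx : x ∈ U) : 0 < ((2 * π) • (g x)⁻¹).det :=
  ((hg.posDef x hx).inv.smul (by positivity : (0 : ℝ) < 2 * π)).det_pos

/-- The two normalizations by the determinant of the metric are inverse to each other. -/
theorem IsRiemannianMetric.sqrt_mul_volumeDensity (hg : IsRiemannianMetric U g) {x : Fin n → ℝ}
    (hx : x ∈ U) : √((2 * π) • (g x)⁻¹).det * volumeDensity g x = 1 := by
  rw [volumeDensity, ← Real.sqrt_mul (hg.det_smul_inv_pos hx).le, ← Matrix.det_mul,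
    Matrix.smul_mul, Matrix.mul_smul, smul_smul, hg.inv_mul hx, mul_inv_cancel₀ (by positivity),
    one_smul, Matrix.det_one, Real.sqrt_one]

/-- If the differential of the potential is dual to the vector `X`, then `ψ² = |X|²`. -/
theorem IsRiemannianMetric.psiSq_eq (hg : IsRiemannianMetric U g) {x X : Fin n → ℝ} (hx : x ∈ U)
    (h : fderiv ℝ (infoPotential g ρ) x = metricForm g x X) :
    psiSq g ρ x = metricForm g x X X := by
  have h1 : (fun i => -pderiv i (infoPotential g ρ) x) = -(g x *ᵥ X) := by
    funext i
    rw [pderiv, h, hg.metricForm_symm hx, metricForm_apply, pairing]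
    simp [Matrix.mulVec, dotProduct, Pi.single_apply]
  have h2 : ∀ (A : Matrix (Fin n) (Fin n) ℝ) (v w : Fin n → ℝ), pairing A v w = v ⬝ᵥ (A *ᵥ w) := by
    intro A v w
    simp only [pairing, dotProduct, Matrix.mulVec, Finset.mul_sum]
    refine Finset.sum_congr rfl fun i _ => Finset.sum_congr rfl fun j _ => ?_
    ring
  rw [psiSq, h1, h2, metricForm_apply, h2, Matrix.mulVec_neg, Matrix.mulVec_mulVec, hg.inv_mul hx,
    Matrix.one_mulVec, neg_dotProduct_neg, dotProduct_comm]

namespace IsFluctuationMetric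

variable (hU : IsOpen U) (hg : IsRiemannianMetric U g) (hF : IsFluctuationMetric U g ρ)
include hF hg

theorem contDiffOn_infoPotential : ContDiffOn ℝ ∞ (infoPotential g ρ) U := by
  unfold infoPotential weight
  have h1 : ContDiffOn ℝ ∞ (fun x => √((2 * π) • (g x)⁻¹).det) U := by
    refine ContDiffOn.sqrt ?_ fun x hx => (hg.det_smul_inv_pos hx).ne'
    refine contDiffOn_det fun i j => ?_
    simp only [Matrix.smul_apply, smul_eq_mul]
    exact contDiffOn_const.mul (hg.contDiffOn_inv i j)
  refine (hF.smooth.mul h1).log fun x hx => ?_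
  exact (mul_pos (hF.pos x hx) (Real.sqrt_pos.2 (hg.det_smul_inv_pos hx))).ne'

theorem exp_infoPotential {x : Fin n → ℝ} (hx : x ∈ U) :
    Real.exp (infoPotential g ρ x) * volumeDensity g x = ρ x := by
  rw [infoPotential, weight, Real.exp_log
    (mul_pos (hF.pos x hx) (Real.sqrt_pos.2 (hg.det_smul_inv_pos hx))), mul_assoc,
    hg.sqrt_mul_volumeDensity hx, mul_one]

include hU

theorem hasFDerivAt_fderiv_infoPotential {x : Fin n → ℝ} (hx : x ∈ U) :
    HasFDerivAt (fderiv ℝ (infoPotential g ρ))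
      (fderiv ℝ (fderiv ℝ (infoPotential g ρ)) x) x := by
  have := (hF.contDiffOn_infoPotential hg).fderiv_of_isOpen (m := ∞) hU (by simp)
  exact ((this.contDiffAt (hU.mem_nhds hx)).differentiableAt (by simp)).hasFDerivAt

/-- The metric equation `g = -D D 𝒮` as an identity of bilinear forms. -/
theorem metricForm_eq {x : Fin n → ℝ} (hx : x ∈ U) (u w : Fin n → ℝ) :
    metricForm g x u w = -fderiv ℝ (fderiv ℝ (infoPotential g ρ)) x u w
      + fderiv ℝ (infoPotential g ρ) x (connection g x u w) := by
  have hS : ContDiffAt ℝ 2 (infoPotential g ρ) x :=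
    ((hF.contDiffOn_infoPotential hg).contDiffAt (hU.mem_nhds hx)).of_le (by norm_cast)
  have h1 : fderiv ℝ (fderiv ℝ (infoPotential g ρ)) x u w
      = ∑ i, ∑ j, pderiv i (pderiv j (infoPotential g ρ)) x * u i * w j := by
    rw [fderiv_apply_eq_sum _ u, _root_.sum_apply]
    refine Finset.sum_congr rfl fun i _ => ?_
    rw [smul_apply, fderiv_apply_eq_sum _ w, Finset.smul_sum]
    refine Finset.sum_congr rfl fun j _ => ?_
    rw [pderiv_pderiv hS]
    simp only [smul_eq_mul]
    ring
  have h2 : fderiv ℝ (infoPotential g ρ) x (connection g x u w)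
      = ∑ i, ∑ j, (∑ k, christoffel g x k i j * pderiv k (infoPotential g ρ) x) * u i * w j := by
    rw [fderiv_apply_eq_sum]
    simp only [connection_apply, Finset.sum_mul, smul_eq_mul]
    rw [Finset.sum_comm]
    refine Finset.sum_congr rfl fun i _ => ?_
    rw [Finset.sum_comm]
    refine Finset.sum_congr rfl fun j _ => Finset.sum_congr rfl fun k _ => ?_
    rw [pderiv]
    ring
  rw [h1, h2, metricForm_apply, pairing, ← Finset.sum_neg_distrib, ← Finset.sum_add_distrib]
  refine Finset.sum_congr rfl fun i _ => ?_
  rw [← Finset.sum_neg_distrib, ← Finset.sum_add_distrib]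
  refine Finset.sum_congr rfl fun j _ => ?_
  rw [hF.metric_eq x hx]
  ring

/-- The identity `𝒮 + ψ²/2 = const`. -/
theorem infoPotential_add_psiSq (hx₀ : x₀ ∈ U)
    (hmax : IsMaxOn (infoPotential g ρ) U x₀) {x : Fin n → ℝ} (hx : x ∈ U) :
    infoPotential g ρ x + 1 / 2 * psiSq g ρ x = infoPotential g ρ x₀ := by
  set S := infoPotential g ρ with hS
  -- `X` is the gradient of 𝒮. The metric equation means D_u X = -u, so d(ψ²/2)(u) = g(D_u X, X) =
  -- -g(u, X) = -d𝒮(u).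
  set X : (Fin n → ℝ) → (Fin n → ℝ) := fun x i => ∑ j, (g x)⁻¹ i j * pderiv j S x with hX
  have hXs : ContDiffOn ℝ ∞ X U := by
    refine contDiffOn_pi.2 fun i => ContDiffOn.sum fun j _ => ?_
    exact (hg.contDiffOn_inv i j).mul (contDiffOn_pderiv hU (hF.contDiffOn_infoPotential hg) j)
  have hdual : ∀ y ∈ U, fderiv ℝ S y = metricForm g y (X y) := by
    intro y hy
    have h1 : g y *ᵥ X y = fun j => pderiv j S y := by
      have : X y = (g y)⁻¹ *ᵥ fun j => pderiv j S y := rfl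
      rw [this, Matrix.mulVec_mulVec, hg.mul_inv hy, Matrix.one_mulVec]
    ext1 w
    rw [fderiv_apply_eq_sum, hg.metricForm_symm hy, metricForm_apply, pairing]
    refine Finset.sum_congr rfl fun i _ => ?_
    have h2 := congrFun h1 i
    rw [pderiv] at h2
    rw [← h2, smul_eq_mul, Matrix.mulVec, dotProduct, Finset.mul_sum]
    refine Finset.sum_congr rfl fun j _ => ?_
    ring
  have hψ : ∀ y ∈ U, psiSq g ρ y = fderiv ℝ S y (X y) := by
    intro y hy
    rw [hg.psiSq_eq hy (hdual y hy), hdual y hy]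
  have hderiv : ∀ y ∈ U, HasFDerivAt (fun y => S y + 1 / 2 * psiSq g ρ y)
      (0 : (Fin n → ℝ) →L[ℝ] ℝ) y := by
    intro y hy
    have dS : HasFDerivAt S (fderiv ℝ S y) y :=
      (((hF.contDiffOn_infoPotential hg).contDiffAt (hU.mem_nhds hy)).differentiableAt
        (by simp)).hasFDerivAt
    have dθ := hF.hasFDerivAt_fderiv_infoPotential hU hg hy
    have dX : HasFDerivAt X (fderiv ℝ X y) y :=
      ((hXs.contDiffAt (hU.mem_nhds hy)).differentiableAt (by simp)).hasFDerivAt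
    have d1 := dθ.clm_apply dX
    have dg := hg.hasFDerivAt_metricForm hU hy
    have dgX := (dg.clm_apply dX).clm_apply (hasFDerivAt_const (X y) y)
    have dθc := dθ.clm_apply (hasFDerivAt_const (X y) y)
    -- With the second argument frozen at `X y`, differentiating d𝒮 = g(X, ·) expresses g(∂_u X, X)
    -- through the Hessian of 𝒮 and ∂g, so the derivative of `X` itself is never computed.
    have hev : (fun z => fderiv ℝ S z (X y)) =ᶠ[𝓝 y] fun z => metricForm g z (X z) (X y) := by
      filter_upwards [hU.mem_nhds hy] with z hz
      rw [hdual z hz]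
    have hD := (dθc.congr_of_eventuallyEq hev.symm).unique dgX
    have hev2 : (fun y => S y + 1 / 2 * psiSq g ρ y)
        =ᶠ[𝓝 y] fun y => S y + 1 / 2 * fderiv ℝ S y (X y) := by
      filter_upwards [hU.mem_nhds hy] with z hz
      rw [hψ z hz]
    refine HasFDerivAt.congr_of_eventuallyEq ?_ hev2
    refine (dS.fun_add (d1.const_mul (1 / 2))).congr_fderiv ?_
    ext1 u
    have hDu := congrArg (fun L => L u) hD
    simp only [add_apply, smul_apply, ContinuousLinearMap.comp_apply,
      ContinuousLinearMap.flip_apply, smul_eq_mul, ContinuousLinearMap.comp_zero, zero_add,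
      _root_.zero_apply] at hDu ⊢
    have hH := hF.metricForm_eq hU hg hy u (X y)
    have hM := hg.fderiv_metricForm hU hy u (X y) (X y)
    have hθu : fderiv ℝ S y u = metricForm g y u (X y) := by
      rw [hdual y hy, hg.metricForm_symm hy]
    have hθΓ : fderiv ℝ S y (connection g y u (X y))
        = metricForm g y (X y) (connection g y u (X y)) := by rw [hdual y hy]
    have hθD : fderiv ℝ S y (fderiv ℝ X y u) = metricForm g y (fderiv ℝ X y u) (X y) := by
      rw [hdual y hy, hg.metricForm_symm hy]
    have hsymm := hg.metricForm_symm hy (connection g y u (X y)) (X y)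
    rw [← hS] at hH
    rw [hθu, hθD]
    rw [hθΓ] at hH
    linarith
  have hconst := hU.is_const_of_fderiv_eq_zero (f := fun y => S y + 1 / 2 * psiSq g ρ y)
    hF.preconnected (fun y hy => (hderiv y hy).differentiableAt.differentiableWithinAt)
    (fun y hy => (hderiv y hy).fderiv) hx hx₀
  -- At the maximum the differential vanishes, hence ψ² does too, which fixes the constant.
  have h0 : fderiv ℝ S x₀ = metricForm g x₀ 0 := by
    rw [_root_.map_zero]
    exact (hmax.isLocalMax (hU.mem_nhds hx₀)).fderiv_eq_zero
  have h1 : psiSq g ρ x₀ = 0 := by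
    rw [hg.psiSq_eq hx₀ h0]
    simp
  simpa [h1] using hconst

/-- The Riemannian gaussian representation of the density. -/
theorem density_eq (hx₀ : x₀ ∈ U) (hmax : IsMaxOn (infoPotential g ρ) U x₀) {x : Fin n → ℝ}
    (hx : x ∈ U) : ρ x = Real.exp (infoPotential g ρ x₀) *
      (Real.exp (-(1 / 2) * psiSq g ρ x) * volumeDensity g x) := by
  rw [← hF.exp_infoPotential hg hx, ← mul_assoc, ← Real.exp_add,
    ← hF.infoPotential_add_psiSq hU hg hx₀ hmax hx]
  congr 2
  ring

/-- Integrate the gaussian form of ρ against total mass one. The resulting product equal to 1 also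
shows that 𝒵 is nonzero. -/
theorem partitionFunction_eq (hx₀ : x₀ ∈ U) (hmax : IsMaxOn (infoPotential g ρ) U x₀) :
    1 / partitionFunction U g ρ = Real.exp (infoPotential g ρ x₀) := by
  have h1 := hF.integral_eq_one
  rw [setIntegral_congr_fun hU.measurableSet fun x hx => hF.density_eq hU hg hx₀ hmax hx,
    integral_const_mul] at h1
  exact (eq_one_div_of_mul_eq_one_left h1).symm

end IsFluctuationMetric

/-! ### Rigidity: radial gradient and constant Jacobian -/

namespace IsExponentialMap

variable (hU : IsOpen U) (hg : IsRiemannianMetric U g) (hx₀ : x₀ ∈ U) (hδ : 0 < δ)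
  (hE : IsExponentialMap U g x₀ δ E)
include hU hg hx₀ hE

include hδ in
/-- The radial geodesics have constant speed. -/
theorem metricForm_velocity {v : Fin n → ℝ} (hv : v ∈ tangentBall g x₀ δ) :
    metricForm g (E v) (fderiv ℝ E v v) (fderiv ℝ E v v) = metricForm g x₀ v v := by
  have hd : ∀ t ∈ Icc (0 : ℝ) 1, HasDerivAt (fun t : ℝ =>
      metricForm g (E (t • v)) (fderiv ℝ E (t • v) v) (fderiv ℝ E (t • v) v)) 0 t := by
    intro t ht
    have htv := hg.smul_mem_tangentBall hx₀ hv ht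
    have hx := hE.mem htv
    have dE := hasDerivAt_ray (f := E) (hE.differentiableAt htv)
    have dV := (hasDerivAt_ray (f := fderiv ℝ E) (hE.differentiableAt_fderiv htv)).clm_apply
      (hasDerivAt_const t v)
    have dg : HasDerivAt (fun t : ℝ => metricForm g (E (t • v)))
        (fderiv ℝ (metricForm g) (E (t • v)) (fderiv ℝ E (t • v) v)) t :=
      HasFDerivAt.comp_hasDerivAt (l := metricForm g) (f := fun t : ℝ => E (t • v)) t
        (hg.hasFDerivAt_metricForm hU hx) dE
    refine ((dg.clm_apply dV).clm_apply dV).congr_deriv ?_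
    have hgeo := eq_neg_of_add_eq_zero_left (hE.geodesic_eq hg hx₀ hv ht)
    rw [_root_.map_zero, add_zero, add_apply, hgeo, hg.fderiv_metricForm hU hx]
    simp only [map_neg, neg_apply]
    ring
  have := constant_of_has_deriv_right_zero (fun t ht => (hd t ht).continuousAt.continuousWithinAt)
    (fun t ht => (hd t (Ico_subset_Icc_self ht)).hasDerivWithinAt) 1 (by simp)
  simpa [hE.map_zero, hE.fderiv_zero hδ] using this

variable (hF : IsFluctuationMetric U g ρ) (hmax : IsMaxOn (infoPotential g ρ) U x₀)
include hF hmax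

/-- The gradient of the information potential is radial. -/
theorem fderiv_infoPotential {v : Fin n → ℝ} (hv : v ∈ tangentBall g x₀ δ) :
    fderiv ℝ (infoPotential g ρ) (E v) = -metricForm g (E v) (fderiv ℝ E v v) := by
  set S := infoPotential g ρ with hS
  -- Along the geodesic γ, the covariant derivative of d𝒮 is -g(γ', ·) and that of t g(γ', ·) is
  -- g(γ', ·); hence `β` is parallel, that is, β' = β ∘ Γ(γ').
  set β : ℝ → (Fin n → ℝ) →L[ℝ] ℝ := fun t =>
    fderiv ℝ S (E (t • v)) + t • metricForm g (E (t • v)) (fderiv ℝ E (t • v) v) with hβ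
  have hd : ∀ t ∈ Icc (0 : ℝ) 1, HasDerivAt β
      ((β t).comp (connection g (E (t • v)) (fderiv ℝ E (t • v) v))) t := by
    intro t ht
    have htv := hg.smul_mem_tangentBall hx₀ hv ht
    have hx := hE.mem htv
    have dE := hasDerivAt_ray (f := E) (hE.differentiableAt htv)
    have dV := (hasDerivAt_ray (f := fderiv ℝ E) (hE.differentiableAt_fderiv htv)).clm_apply
      (hasDerivAt_const t v)
    have dg : HasDerivAt (fun t : ℝ => metricForm g (E (t • v)))
        (fderiv ℝ (metricForm g) (E (t • v)) (fderiv ℝ E (t • v) v)) t :=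
      HasFDerivAt.comp_hasDerivAt (l := metricForm g) (f := fun t : ℝ => E (t • v)) t
        (hg.hasFDerivAt_metricForm hU hx) dE
    have dθ : HasDerivAt (fun t : ℝ => fderiv ℝ S (E (t • v)))
        (fderiv ℝ (fderiv ℝ S) (E (t • v)) (fderiv ℝ E (t • v) v)) t :=
      HasFDerivAt.comp_hasDerivAt (l := fderiv ℝ S) (f := fun t : ℝ => E (t • v)) t
        (hF.hasFDerivAt_fderiv_infoPotential hU hg hx) dE
    refine (dθ.fun_add ((hasDerivAt_id t).fun_smul (dg.clm_apply dV))).congr_deriv ?_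
    have hgeo := eq_neg_of_add_eq_zero_left (hE.geodesic_eq hg hx₀ hv ht)
    ext1 w
    have hH := hF.metricForm_eq hU hg hx (fderiv ℝ E (t • v) v) w
    rw [← hS] at hH
    rw [_root_.map_zero, add_zero, hgeo]
    simp only [hβ, add_apply, smul_apply, smul_eq_mul, ContinuousLinearMap.comp_apply,
      hg.fderiv_metricForm hU hx, map_neg, neg_apply, id_eq, one_mul]
    rw [hH]
    ring
  have hcont : ContinuousOn (fun t : ℝ => connection g (E (t • v)) (fderiv ℝ E (t • v) v))
      (Icc 0 1) := by
    intro t ht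
    have htv := hg.smul_mem_tangentBall hx₀ hv ht
    have cE := (hasDerivAt_ray (f := E) (hE.differentiableAt htv)).continuousAt
    have cV := ((hasDerivAt_ray (f := fderiv ℝ E) (hE.differentiableAt_fderiv htv)).clm_apply
      (hasDerivAt_const t v)).continuousAt
    have cΓ : ContinuousAt (fun t : ℝ => connection g (E (t • v))) t :=
      ContinuousAt.comp (g := connection g) (f := fun t : ℝ => E (t • v))
        (hg.hasFDerivAt_connection hU (hE.mem htv)).continuousAt cE
    exact (cΓ.clm_apply cV).continuousWithinAt
  obtain ⟨K, hK⟩ := isCompact_Icc.exists_bound_of_continuousOn hcont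
  have hβ0 : β 0 = 0 := by
    have h1 : fderiv ℝ S x₀ = 0 := (hmax.isLocalMax (hU.mem_nhds hx₀)).fderiv_eq_zero
    simp [hβ, hE.map_zero, h1]
  -- Uniqueness for this linear equation by Grönwall, Γ(γ') being bounded on the compact parameter
  -- interval.
  have hzero := eq_zero_of_abs_deriv_le_mul_abs_self_of_eq_zero_right (K := K)
    (fun t ht => (hd t ht).continuousAt.continuousWithinAt)
    (fun t ht => (hd t (Ico_subset_Icc_self ht)).hasDerivWithinAt) hβ0
    (fun t ht => by
      refine (ContinuousLinearMap.opNorm_comp_le _ _).trans ?_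
      rw [mul_comm]
      gcongr
      exact hK t (Ico_subset_Icc_self ht)) 1 (by simp)
  simp only [hβ, one_smul] at hzero
  exact eq_neg_of_add_eq_zero_left hzero

/-- The differential of the exponential map is parallel along the radial geodesics. -/
theorem covDeriv_self {v : Fin n → ℝ} (hv : v ∈ tangentBall g x₀ δ) :
    covDeriv g E v v = 0 := by
  set S := infoPotential g ρ with hS
  have hx := hE.mem hv
  ext1 w
  refine hg.eq_zero_of_metricForm_eq_zero hx fun z => ?_
  have dE := (hE.differentiableAt hv).hasFDerivAt
  have dV := (hE.differentiableAt_fderiv hv).hasFDerivAt.clm_apply (hasFDerivAt_id v)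
  have dg : HasFDerivAt (fun y => metricForm g (E y))
      ((fderiv ℝ (metricForm g) (E v)).comp (fderiv ℝ E v)) v :=
    HasFDerivAt.comp (g := metricForm g) (f := E) v (hg.hasFDerivAt_metricForm hU hx) dE
  have dθ : HasFDerivAt (fun y => fderiv ℝ S (E y))
      ((fderiv ℝ (fderiv ℝ S) (E v)).comp (fderiv ℝ E v)) v :=
    HasFDerivAt.comp (g := fderiv ℝ S) (f := E) v
      (hF.hasFDerivAt_fderiv_infoPotential hU hg hx) dE
  have d1 := (dg.clm_apply dV).clm_apply (hasFDerivAt_const z v)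
  have d2 := dθ.clm_apply (hasFDerivAt_const z v)
  have hev : (fun y => fderiv ℝ S (E y) z)
      =ᶠ[𝓝 v] fun y => -metricForm g (E y) (fderiv ℝ E y y) z := by
    filter_upwards [isOpen_tangentBall.mem_nhds hv] with y hy
    rw [hE.fderiv_infoPotential hU hg hx₀ hF hmax hy, neg_apply]
  -- Differentiate the radial gradient formula in direction `w`. By the metric equation one side is
  -- covariantly -g(DE w, z), the other -g(DE w, z) - g((D_w DE) v, z). So (D_w DE) v = 0, and
  -- symmetry exchanges `v` and `w`.
  have h1 := congrArg (fun L => L w) ((d2.congr_of_eventuallyEq hev.symm).unique d1.fun_neg)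
  have hH := hF.metricForm_eq hU hg hx (fderiv ℝ E v w) z
  rw [← hS, hE.fderiv_infoPotential hU hg hx₀ hF hmax hv] at hH
  have hM := hg.fderiv_metricForm hU hx (fderiv ℝ E v w) (fderiv ℝ E v v) z
  simp only [add_apply, ContinuousLinearMap.comp_apply, ContinuousLinearMap.flip_apply, neg_apply,
    ContinuousLinearMap.comp_zero, zero_add, ContinuousLinearMap.id_apply, id_eq, map_add] at h1 hH
  rw [covDeriv, add_apply, ContinuousLinearMap.comp_apply, map_add, add_apply,
    hE.fderiv_fderiv_symm hv, hg.connection_symm hU hx]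
  linarith

include hδ in
/-- The metric is flat on the geodesic ball: the Riemannian Jacobian is constant. -/
theorem expJacobian_eq {v : Fin n → ℝ} (hv : v ∈ tangentBall g x₀ δ) :
    expJacobian g E v = √(g x₀).det := by
  have hd : ∀ t ∈ Icc (0 : ℝ) 1, HasDerivAt (fun t : ℝ => expJacobian g E (t • v)) 0 t := by
    intro t ht
    have htv := hg.smul_mem_tangentBall hx₀ hv ht
    have hdiff := ((hE.contDiffOn_expJacobian hg).contDiffAt
      (isOpen_tangentBall.mem_nhds htv)).differentiableAt (by simp)
    refine (hasDerivAt_ray hdiff).congr_deriv ?_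
    -- `covDeriv_self` at the point `t • v` concerns the direction `t • v`, so `t` must be divided
    -- out; at t = 0 the centre is a critical point of the Jacobian.
    rcases eq_or_ne t 0 with rfl | ht0
    · rw [zero_smul, hE.fderiv_expJacobian_zero hU hg hx₀ hδ]
      rfl
    · have h1 := hE.fderiv_expJacobian hU hg htv (t • v)
      rw [hE.covDeriv_self hU hg hx₀ hF hmax htv, map_smul] at h1
      have h2 : t • fderiv ℝ (expJacobian g E) (t • v) v = 0 := by
        rw [h1]
        simp [toMat]
      exact (smul_eq_zero.1 h2).resolve_left ht0
  have := constant_of_has_deriv_right_zero (fun t ht => (hd t ht).continuousAt.continuousWithinAt)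
    (fun t ht => (hd t (Ico_subset_Icc_self ht)).hasDerivWithinAt) 1 (by simp)
  simpa [hE.expJacobian_zero hδ] using this

include hδ in
/-- The Riemannian gaussian representation of the density in the geodesic ball. -/
theorem density_eq {v : Fin n → ℝ} (hv : v ∈ tangentBall g x₀ δ) :
    ρ (E v) = 1 / partitionFunction U g ρ * Real.exp (-(1 / 2) * pairing (g x₀) v v)
      * volumeDensity g (E v) := by
  have hx := hE.mem hv
  -- The gradient is minus the radial velocity, so ψ² is the squared speed, which is conserved and
  -- equals its value at the centre.
  have h1 : fderiv ℝ (infoPotential g ρ) (E v) = metricForm g (E v) (-fderiv ℝ E v v) := by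
    rw [map_neg, hE.fderiv_infoPotential hU hg hx₀ hF hmax hv]
  have h2 : psiSq g ρ (E v) = pairing (g x₀) v v := by
    rw [hg.psiSq_eq hx h1, ← metricForm_apply, ← hE.metricForm_velocity hU hg hx₀ hδ hv]
    simp
  rw [hF.density_eq hU hg hx₀ hmax hx, hF.partitionFunction_eq hU hg hx₀ hmax, h2, mul_assoc]

end IsExponentialMap

end Fluctuation

end FluctuationGeometry

end

/-! ### The two expansions -/

theorem theorem2 {m : ℕ} (U : Set (Fin (m + 1) → ℝ)) (hU : IsOpen U)
    (g : (Fin (m + 1) → ℝ) → Matrix (Fin (m + 1)) (Fin (m + 1)) ℝ)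
    (hg : FluctuationGeometry.IsRiemannianMetric U g)
    (ρ : (Fin (m + 1) → ℝ) → ℝ)
    (x₀ : Fin (m + 1) → ℝ) (hx₀ : x₀ ∈ U)
    (δ : ℝ) (hδ : 0 < δ)
    (E : (Fin (m + 1) → ℝ) → (Fin (m + 1) → ℝ))
    (hE : FluctuationGeometry.IsExponentialMap U g x₀ δ E) :
    -- the distribution of a statistical manifold, about the maximum of the information potential
    (FluctuationGeometry.IsFluctuationMetric U g ρ →
      IsMaxOn (FluctuationGeometry.infoPotential g ρ) U x₀ →
      FluctuationGeometry.HasAsymptoticDistribution g ρ x₀ E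
        (FluctuationGeometry.partitionFunction U g ρ) 4) ∧
    -- any Riemannian metric, with a distribution that has the Riemannian gaussian form near `x₀`
    (∀ Z : ℝ, 0 < Z →
      (∀ v ∈ FluctuationGeometry.tangentBall g x₀ δ,
        ρ (E v) = 1 / Z * Real.exp (-(1 / 2) * FluctuationGeometry.pairing (g x₀) v v)
          * FluctuationGeometry.volumeDensity g (E v)) →
      FluctuationGeometry.HasAsymptoticDistribution g ρ x₀ E Z 3) := by
  refine ⟨fun hF hmax => ?_, fun Z _ hρ => ?_⟩
  · exact FluctuationGeometry.hasAsymptoticDistribution_of_expJacobian_eq hU hg hx₀ hδ hE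
      (fun v hv => hE.density_eq hU hg hx₀ hδ hF hmax hv)
      (fun v hv => hE.expJacobian_eq hU hg hx₀ hδ hF hmax hv) 4
  · exact FluctuationGeometry.hasAsymptoticDistribution_of_gaussian hU hg hx₀ hδ hE hρ
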